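/- Let $G=(X,b,m)$ be a connected, locally finite, infinite weighted graph: $X$ is a countably infinite set, $b:X\times X\to[0,\infty)$ is symmetric with $b(x,x)=0$ and $\{y : b(x,y)>0\}$ finite for every $x$, $m:X\to(0,\infty)$, and the graph with $x\sim y$ iff $b(x,y)>0$ is connected. Let $L$ be the Friedrichs extension in $\ell^2(X,m)$ of the operator $\mathcal L f(x)=\frac1{m(x)}\sum_{y}b(x,y)(f(x)-f(y))$ defined on the finitely supported functions, and let $p_t(x,y)$, $t>0$, be its heat kernel, that is, $e^{-tL}f(x)=\sum_{y}p_t(x,y)f(y)m(y)$ for all $f\in\ell^2(X,m)$. The graph has the Feller property if for all $x\in X$ and $t>0$ one has $p_t(x,y_n)\to0$ for every sequence $(y_n)$ of vertices that eventually leaves every finite set. For a vertex $x_0$, let $S_r=S_r(x_0)$ be the sphere of radius $r$ about $x_0$ in the combinatorial graph metric, let $\mathrm{Deg}(x)=\frac1{m(x)}\sum_{y\in X}b(x,y)$, for $r\ge1$ and $x\in S_r$ let $\mathrm{Deg}_-(x)=\frac1{m(x)}\sum_{y\in S_{r-1}}b(x,y)$, and let $$D(r)=\max_{x\in S_r}\mathrm{Deg}(x),\qquad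 D_-(r)=\max_{x\in S_r}\mathrm{Deg}_-(x),\qquad d_-(r)=\min_{x\in S_r}\mathrm{Deg}_-(x).$$ (i) If for some vertex $x_0$ $$\sum_{r\ge1}\frac1{D_-(r)}=\infty,$$ then the graph has the Feller property. (ii) If for some vertex $x_0$ $$\sum_{r\ge1}\frac{D(r)-d_-(r)+1}{d_-(r)}<\infty,$$ then the graph does not have the Feller property; moreover, there are no $x\in X$ and $t>0$ such that $p_t(x,y_n)\to0$ for every sequence $(y_n)$ of vertices that eventually leaves every finite set. -/

import Mathlib

open MeasureTheory Filter Topology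
open scoped ENNReal

noncomputable section

/-- The operator `e^{-tA}`, `t > 0`, for a non-negative self-adjoint operator `A` in a Hilbert space
that is given through `R = (1 + A)⁻¹`. The operator `R` is bounded and self-adjoint with spectrum in
`[0,1]`; as `λ = 1/s - 1` for `s = 1/(1 + λ)`, the functional calculus gives `e^{-tA} = φ_t(R)` with
the continuous function `φ_t(s) = e^{-t(1/s - 1)}` for `s > 0` and `φ_t(s) = 0` for `s ≤ 0`. -/
def expNegOfResolvent {H : Type*} [NormedAddCommGroup H] [InnerProductSpace ℂ H] [CompleteSpace H]
    (R : H →L[ℂ] H) (t : ℝ) : H →L[ℂ] H :=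
  cfc (fun s : ℝ => if s ≤ 0 then 0 else Real.exp (-t * (1 / s - 1))) R

/-- A locally finite weighted graph over the vertex set `X`: a symmetric edge weight `b` that
vanishes on the diagonal, with finitely many neighbours at every vertex, and a vertex measure `m`
of full support. Connectedness is stated separately, as `G.graph.Connected`. -/
structure WeightedGraph (X : Type*) where
  b : X → X → ℝ
  m : X → ℝ
  b_nonneg : ∀ x y, 0 ≤ b x y
  b_self : ∀ x, b x x = 0
  b_symm : ∀ x y, b x y = b y x
  finite_nbhd : ∀ x, {y | 0 < b x y}.Finite
  m_pos : ∀ x, 0 < m x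

namespace WeightedGraph

section Combinatorics

variable {X : Type*} (G : WeightedGraph X)

/-- The neighbourhood `{y | y ∼ x}` of a vertex. -/
def nbhd (x : X) : Finset X := (G.finite_nbhd x).toFinset

theorem mem_nbhd {x y : X} : y ∈ G.nbhd x ↔ 0 < G.b x y := by
  simp [nbhd]

/-- The underlying combinatorial graph: `x ∼ y` iff `b(x,y) > 0`. Its distance
`G.graph.dist` is the combinatorial graph metric. -/
def graph : SimpleGraph X where
  Adj x y := 0 < G.b x y
  symm := ⟨fun x y h => by rw [G.b_symm y x]; exact h⟩
  loopless := ⟨fun x h => by rw [G.b_self x] at h; exact lt_irrefl _ h⟩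

/-- The sphere `S_r(x₀)` of the combinatorial graph metric. -/
def sphere (x₀ : X) (r : ℕ) : Set X := {x | G.graph.dist x₀ x = r}

/-- The weighted degree `Deg(x) = (1/m(x)) ∑_y b(x,y)`. -/
def deg (x : X) : ℝ := (1 / G.m x) * ∑ y ∈ G.nbhd x, G.b x y

open scoped Classical in
/-- The inner degree with respect to `x₀`: for `x ∈ S_r(x₀)` it is
`Deg₋(x) = (1/m(x)) ∑_{y ∈ S_{r-1}(x₀)} b(x,y)`, the sphere `S_{-1}` being empty. -/
def innerDeg (x₀ x : X) : ℝ :=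
  (1 / G.m x) *
    ∑ y ∈ (G.nbhd x).filter (fun y => G.graph.dist x₀ y + 1 = G.graph.dist x₀ x), G.b x y

/-- `D(r)`, the maximum of `Deg` over `S_r(x₀)`. -/
def maxDeg (x₀ : X) (r : ℕ) : ℝ := sSup (G.deg '' G.sphere x₀ r)

/-- `D₋(r)`, the maximum of `Deg₋` over `S_r(x₀)`. -/
def maxInnerDeg (x₀ : X) (r : ℕ) : ℝ := sSup (G.innerDeg x₀ '' G.sphere x₀ r)

/-- `d₋(r)`, the minimum of `Deg₋` over `S_r(x₀)`. -/
def minInnerDeg (x₀ : X) (r : ℕ) : ℝ := sInf (G.innerDeg x₀ '' G.sphere x₀ r)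

/-- The formal Laplacian `ℒ f(x) = (1/m(x)) ∑_y b(x,y) (f(x) - f(y))`. -/
def formalLaplacian (f : X → ℂ) (x : X) : ℂ :=
  (1 / (G.m x : ℂ)) * ∑ y ∈ G.nbhd x, (G.b x y : ℂ) * (f x - f y)

/-- The energy `Q(f) = (1/2) ∑_{x,y} b(x,y) |f(x) - f(y)|²`, with values in `[0, ∞]`. -/
def energy (f : X → ℂ) : ℝ≥0∞ :=
  (1 / 2) * ∑' x, ∑' y, ENNReal.ofReal (G.b x y) * ‖f x - f y‖ₑ ^ 2

theorem formalLaplacian_add (f g : X → ℂ) (x : X) :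
    G.formalLaplacian (f + g) x = G.formalLaplacian f x + G.formalLaplacian g x := by
  simp only [formalLaplacian, Pi.add_apply, ← mul_add, ← Finset.sum_add_distrib]
  congr 1
  exact Finset.sum_congr rfl fun y _ => by ring

theorem formalLaplacian_smul (c : ℂ) (f : X → ℂ) (x : X) :
    G.formalLaplacian (c • f) x = c * G.formalLaplacian f x := by
  simp only [formalLaplacian, Pi.smul_apply, smul_eq_mul, Finset.mul_sum]
  exact Finset.sum_congr rfl fun y _ => by ring

/-- `ℒ` maps finitely supported functions to finitely supported functions. -/
theorem finite_support_formalLaplacian {f : X → ℂ} (hf : (Function.support f).Finite) :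
    (Function.support (G.formalLaplacian f)).Finite := by
  refine (hf.union (hf.biUnion fun z _ => (G.nbhd z).finite_toSet)).subset fun x hx => ?_
  by_contra h
  simp only [Set.mem_union, Set.mem_iUnion, not_or, not_exists, Function.mem_support,
    not_not] at h
  refine hx ?_
  simp only [formalLaplacian]
  rw [Finset.sum_eq_zero, mul_zero]
  intro y hy
  have hy' : f y = 0 := by
    by_contra hfy
    refine h.2 y hfy ?_
    simp only [nbhd, Set.Finite.coe_toFinset, Set.Finite.mem_toFinset, Set.mem_ofPred_eq] at hy ⊢
    rwa [G.b_symm]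
  simp [h.1, hy']

theorem energy_add_le (f g : X → ℂ) : G.energy (f + g) ≤ 2 * G.energy f + 2 * G.energy g := by
  have key : ∀ a c : ℂ, ‖a + c‖ₑ ^ 2 ≤ 2 * ‖a‖ₑ ^ 2 + 2 * ‖c‖ₑ ^ 2 := by
    intro a c
    have h : ‖a + c‖₊ ^ 2 ≤ 2 * ‖a‖₊ ^ 2 + 2 * ‖c‖₊ ^ 2 := by
      rw [← NNReal.coe_le_coe]
      push_cast
      have h1 := norm_add_le a c
      nlinarith [sq_nonneg (‖a‖ - ‖c‖), norm_nonneg (a + c), norm_nonneg a, norm_nonneg c]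
    simp only [enorm_eq_nnnorm]
    exact_mod_cast h
  have hsum : (∑' x, ∑' y, ENNReal.ofReal (G.b x y) * ‖(f + g) x - (f + g) y‖ₑ ^ 2) ≤
      2 * (∑' x, ∑' y, ENNReal.ofReal (G.b x y) * ‖f x - f y‖ₑ ^ 2) +
      2 * (∑' x, ∑' y, ENNReal.ofReal (G.b x y) * ‖g x - g y‖ₑ ^ 2) := by
    simp only [← ENNReal.tsum_mul_left, ← ENNReal.tsum_add]
    refine ENNReal.tsum_le_tsum fun x => ENNReal.tsum_le_tsum fun y => ?_
    have h2 : (f + g) x - (f + g) y = (f x - f y) + (g x - g y) := by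
      simp only [Pi.add_apply]; ring
    rw [h2]
    calc _ ≤ ENNReal.ofReal (G.b x y) * (2 * ‖f x - f y‖ₑ ^ 2 + 2 * ‖g x - g y‖ₑ ^ 2) := by
          gcongr; exact key _ _
      _ = _ := by ring
  calc G.energy (f + g) ≤ (1 / 2) *
        (2 * (∑' x, ∑' y, ENNReal.ofReal (G.b x y) * ‖f x - f y‖ₑ ^ 2) +
        2 * (∑' x, ∑' y, ENNReal.ofReal (G.b x y) * ‖g x - g y‖ₑ ^ 2)) := by
          unfold energy; gcongr
    _ = _ := by unfold energy; ring

theorem energy_smul (c : ℂ) (f : X → ℂ) : G.energy (c • f) = ‖c‖ₑ ^ 2 * G.energy f := by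
  have h : ∀ x y, ENNReal.ofReal (G.b x y) * ‖(c • f) x - (c • f) y‖ₑ ^ 2 =
      ‖c‖ₑ ^ 2 * (ENNReal.ofReal (G.b x y) * ‖f x - f y‖ₑ ^ 2) := by
    intro x y
    have h2 : (c • f) x - (c • f) y = c * (f x - f y) := by
      simp only [Pi.smul_apply, smul_eq_mul]; ring
    rw [h2, enorm_mul]
    ring
  unfold energy
  simp only [h, ENNReal.tsum_mul_left]
  ring

/-- The weighted gradient `√(b(x,y)/2) (f(x) - f(y))`. -/
def grad (f : X → ℂ) (e : X × X) : ℂ := (√(G.b e.1 e.2 / 2) : ℂ) * (f e.1 - f e.2)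

theorem finite_support_grad {f : X → ℂ} (hf : (Function.support f).Finite) :
    (Function.support (G.grad f)).Finite := by
  have h1 : (⋃ z ∈ Function.support f, ((fun y => (z, y)) '' (G.nbhd z : Set X)) ∪
      ((fun y => (y, z)) '' (G.nbhd z : Set X))).Finite :=
    hf.biUnion fun z _ => ((G.nbhd z).finite_toSet.image _).union ((G.nbhd z).finite_toSet.image _)
  refine h1.subset ?_
  rintro ⟨x, y⟩ h
  have hb : 0 < G.b x y := by
    refine lt_of_le_of_ne (G.b_nonneg x y) fun h0 => h ?_
    simp [grad, ← h0]
  simp only [Set.mem_iUnion]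
  by_cases hx : f x = 0
  · refine ⟨y, fun hy => h ?_, Or.inr ⟨x, ?_, rfl⟩⟩
    · simp [grad, hx, hy]
    · rw [Finset.mem_coe, mem_nbhd, G.b_symm]; exact hb
  · exact ⟨x, hx, Or.inl ⟨y, by rw [Finset.mem_coe, mem_nbhd]; exact hb, rfl⟩⟩

/-- Square summable functions on the pairs of vertices. -/
abbrev EdgeL2 (_ : WeightedGraph X) : Type _ := lp (fun _ : X × X => ℂ) 2

theorem energy_eq {h : X → ℂ} {z : G.EdgeL2} (hz : ∀ e, z e = G.grad h e) :
    G.energy h = ‖z‖ₑ ^ 2 := by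
  have h1 : ∀ e : X × X, ENNReal.ofReal (‖z e‖ ^ 2) =
      (1 / 2) * (ENNReal.ofReal (G.b e.1 e.2) * ‖h e.1 - h e.2‖ₑ ^ 2) := by
    intro e
    have hb := G.b_nonneg e.1 e.2
    rw [hz, grad, norm_mul, mul_pow, Complex.norm_real, Real.norm_eq_abs, sq_abs,
      Real.sq_sqrt (by positivity), ENNReal.ofReal_mul (by positivity), div_eq_inv_mul,
      ENNReal.ofReal_mul (by positivity), ENNReal.ofReal_inv_of_pos (by norm_num),
      ENNReal.ofReal_pow (norm_nonneg _), ofReal_norm, mul_assoc]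
    simp
  have h2 : HasSum (fun e => ‖z e‖ ^ 2) (‖z‖ ^ 2) := by
    have := lp.hasSum_norm (by norm_num : 0 < (2 : ℝ≥0∞).toReal) z
    simpa using this
  unfold energy
  rw [← ENNReal.tsum_prod (f := fun x y => ENNReal.ofReal (G.b x y) * ‖h x - h y‖ₑ ^ 2),
    ← ENNReal.tsum_mul_left]
  simp only [← h1]
  rw [← ENNReal.ofReal_tsum_of_nonneg (fun _ => by positivity) h2.summable, h2.tsum_eq,
    ENNReal.ofReal_pow (norm_nonneg _), ofReal_norm]

end Combinatorics

section HeatKernel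

variable {X : Type*} [MeasurableSpace X] [DiscreteMeasurableSpace X] (G : WeightedGraph X)

/-- The vertex measure `m`, extended to all subsets of `X` by countable additivity. -/
def vertexMeasure : Measure X :=
  Measure.sum fun x => ENNReal.ofReal (G.m x) • Measure.dirac x

theorem vertexMeasure_singleton (x : X) : G.vertexMeasure {x} = ENNReal.ofReal (G.m x) := by
  classical
  rw [vertexMeasure, Measure.sum_apply _ (measurableSet_singleton x), tsum_eq_single x]
  · simp
  · intro y hy
    simp [hy]

/-- Every vertex has positive mass, so that "almost everywhere" means "everywhere". -/
theorem eq_of_ae {β : Type*} {f g : X → β} (h : f =ᵐ[G.vertexMeasure] g) : f = g := by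
  funext x
  by_contra hx
  have h0 : G.vertexMeasure {x} = 0 := measure_mono_null (by simpa using hx) (ae_iff.1 h)
  rw [vertexMeasure_singleton, ENNReal.ofReal_eq_zero] at h0
  exact absurd (G.m_pos x) (not_lt.2 h0)

/-- The complex Hilbert space `ℓ²(X,m)`. -/
abbrev L2 : Type _ := Lp ℂ 2 G.vertexMeasure

theorem coe_add (f g : G.L2) : ((f + g : G.L2) : X → ℂ) = f + g := G.eq_of_ae (Lp.coeFn_add f g)

theorem coe_smul (c : ℂ) (f : G.L2) : ((c • f : G.L2) : X → ℂ) = c • (f : X → ℂ) :=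
  G.eq_of_ae (Lp.coeFn_smul c f)

theorem coe_zero : ((0 : G.L2) : X → ℂ) = 0 := G.eq_of_ae (Lp.coeFn_zero ℂ 2 G.vertexMeasure)

theorem memLp_of_finite_support {f : X → ℂ} (hf : (Function.support f).Finite) :
    MemLp f 2 G.vertexMeasure := by
  classical
  have h : f = ∑ x ∈ hf.toFinset, Set.indicator {x} (fun _ => f x) := by
    funext z
    simp only [Finset.sum_apply, Set.indicator_apply, Set.mem_singleton_iff]
    by_cases hz : f z = 0 <;> simp [hz]
  rw [h]
  refine memLp_finsetSum' _ fun x _ => memLp_indicator_const 2 (measurableSet_singleton x) _ ?_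
  exact Or.inr (by rw [vertexMeasure_singleton]; exact ENNReal.ofReal_ne_top)

/-- The finitely supported functions `C_c(X)`, as a subspace of `ℓ²(X,m)`. -/
def finSupp : Submodule ℂ G.L2 where
  carrier := {f | (Function.support (f : X → ℂ)).Finite}
  add_mem' := by
    intro f g hf hg
    simp only [Set.mem_ofPred_eq, coe_add] at *
    exact (hf.union hg).subset (Function.support_add _ _)
  zero_mem' := by
    rw [Set.mem_ofPred_eq, coe_zero, Function.support_zero]
    exact Set.finite_empty
  smul_mem' := by
    intro c f hf
    simp only [Set.mem_ofPred_eq, coe_smul] at *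
    exact hf.subset (Function.support_const_smul_subset c _)

/-- The restriction of the formal Laplacian `ℒ` to `C_c(X)`, as an operator in `ℓ²(X,m)` with
domain `C_c(X)`. -/
def minimalLaplacian : G.L2 →ₗ.[ℂ] G.L2 where
  domain := G.finSupp
  toFun :=
    { toFun := fun f =>
        (G.memLp_of_finite_support (G.finite_support_formalLaplacian f.2)).toLp
      map_add' := by
        intro f g
        rw [← MemLp.toLp_add]
        refine MemLp.toLp_congr _ _ (Eventually.of_forall fun x => ?_)
        rw [Submodule.coe_add, coe_add, formalLaplacian_add, Pi.add_apply]
      map_smul' := by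
        intro c f
        rw [RingHom.id_apply, ← MemLp.toLp_const_smul]
        refine MemLp.toLp_congr _ _ (Eventually.of_forall fun x => ?_)
        rw [Submodule.coe_smul, coe_smul, formalLaplacian_smul, Pi.smul_apply, smul_eq_mul] }

/-- The form domain `D(Q)`: the closure of `C_c(X)` with respect to the form norm
`(‖f‖² + Q(f))^{1/2}`. -/
def formDomain : Submodule ℂ G.L2 where
  carrier := {f | ∀ ε : ℝ≥0∞, 0 < ε → ∃ φ ∈ G.finSupp,
    ‖f - φ‖ₑ ^ 2 + G.energy ((f - φ : G.L2) : X → ℂ) < ε}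
  add_mem' := by
    intro f g hf hg ε hε
    obtain ⟨φ, hφ, h1⟩ := hf (ε / 4) (ENNReal.div_pos hε.ne' (by simp))
    obtain ⟨ψ, hψ, h2⟩ := hg (ε / 4) (ENNReal.div_pos hε.ne' (by simp))
    refine ⟨φ + ψ, add_mem hφ hψ, ?_⟩
    have h3 : f + g - (φ + ψ) = (f - φ) + (g - ψ) := by abel
    rw [h3, coe_add]
    have key : ‖(f - φ) + (g - ψ)‖ₑ ^ 2 ≤ 2 * ‖f - φ‖ₑ ^ 2 + 2 * ‖g - ψ‖ₑ ^ 2 := by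
      have h : ‖(f - φ) + (g - ψ)‖₊ ^ 2 ≤ 2 * ‖f - φ‖₊ ^ 2 + 2 * ‖g - ψ‖₊ ^ 2 := by
        rw [← NNReal.coe_le_coe]
        push_cast
        have h4 := norm_add_le (f - φ) (g - ψ)
        nlinarith [sq_nonneg (‖f - φ‖ - ‖g - ψ‖), norm_nonneg ((f - φ) + (g - ψ)),
          norm_nonneg (f - φ), norm_nonneg (g - ψ)]
      simp only [enorm_eq_nnnorm]
      exact_mod_cast h
    calc _ ≤ (2 * ‖f - φ‖ₑ ^ 2 + 2 * ‖g - ψ‖ₑ ^ 2) + (2 * G.energy ((f - φ : G.L2) : X → ℂ) +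
          2 * G.energy ((g - ψ : G.L2) : X → ℂ)) := add_le_add key (G.energy_add_le _ _)
      _ = 2 * (‖f - φ‖ₑ ^ 2 + G.energy ((f - φ : G.L2) : X → ℂ)) +
          2 * (‖g - ψ‖ₑ ^ 2 + G.energy ((g - ψ : G.L2) : X → ℂ)) := by ring
      _ < 2 * (ε / 4) + 2 * (ε / 4) := by
          refine ENNReal.add_lt_add ?_ ?_ <;>
            exact ENNReal.mul_lt_mul_right (by simp) (by simp) (by assumption)
      _ = ε := by
          rw [← add_mul, div_eq_mul_inv, mul_left_comm, show (2 : ℝ≥0∞) + 2 = 4 by norm_num,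
            ENNReal.mul_inv_cancel (by simp) (by simp), mul_one]
  zero_mem' := by
    intro ε hε
    refine ⟨0, zero_mem _, ?_⟩
    rw [sub_zero, coe_zero]
    simpa [energy] using hε
  smul_mem' := by
    intro c f hf ε hε
    by_cases hc : c = 0
    · refine ⟨0, zero_mem _, ?_⟩
      rw [hc, zero_smul, sub_zero, coe_zero]
      simpa [energy] using hε
    have hc0 : ‖c‖ₑ ^ 2 ≠ 0 := by simpa using hc
    have hct : ‖c‖ₑ ^ 2 ≠ ∞ := by simp
    obtain ⟨φ, hφ, h1⟩ := hf (ε / ‖c‖ₑ ^ 2) (ENNReal.div_pos hε.ne' hct)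
    refine ⟨c • φ, Submodule.smul_mem _ c hφ, ?_⟩
    rw [← smul_sub, coe_smul, energy_smul, enorm_smul, mul_pow, ← mul_add, mul_comm]
    exact (ENNReal.lt_div_iff_mul_lt (Or.inl hc0) (Or.inl hct)).1 h1

/-- The graph Laplacian `L`: the Friedrichs extension (the self-adjoint extension with the smallest
form domain) of the restriction of `ℒ` to `C_c(X)`. It is the adjoint of that restriction,
cut down to the form domain `D(Q)`. -/
def laplacian : G.L2 →ₗ.[ℂ] G.L2 := G.minimalLaplacian.adjoint.domRestrict G.formDomain

theorem vertexMeasure_singleton_ne_top (x : X) : G.vertexMeasure {x} ≠ ∞ := by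
  rw [vertexMeasure_singleton]; exact ENNReal.ofReal_ne_top

/-- `δ_y = 1_y / m(y)`, as an element of `ℓ²(X,m)`. -/
def delta (y : X) : G.L2 :=
  indicatorConstLp 2 (measurableSet_singleton y) (G.vertexMeasure_singleton_ne_top y)
    (1 / (G.m y : ℂ))

theorem coe_delta (y : X) : (G.delta y : X → ℂ) = Set.indicator {y} fun _ => 1 / (G.m y : ℂ) :=
  G.eq_of_ae indicatorConstLp_coeFn

theorem delta_mem (y : X) : G.delta y ∈ G.finSupp := by
  change (Function.support (G.delta y : X → ℂ)).Finite
  rw [coe_delta]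
  exact (Set.finite_singleton y).subset Set.support_indicator_subset

theorem inner_hasSum (f g : G.L2) :
    HasSum (fun x => (G.m x : ℂ) * (starRingEnd ℂ (f x) * g x)) (inner ℂ f g) := by
  have h := hasSum_integral_measure (μ := fun x => ENNReal.ofReal (G.m x) • Measure.dirac x)
    (L2.integrable_inner (𝕜 := ℂ) f g)
  rw [L2.inner_def]
  have he : (fun x => (G.m x : ℂ) * (starRingEnd ℂ (f x) * g x)) = fun x =>
      ∫ a, inner ℂ (f a) (g a) ∂(ENNReal.ofReal (G.m x) • Measure.dirac x) := by
    funext x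
    rw [integral_smul_measure, integral_dirac, ENNReal.toReal_ofReal (G.m_pos x).le]
    simp [RCLike.inner_apply, mul_comm]
  rw [he]
  exact h

theorem inner_delta (y : X) (f : G.L2) : inner ℂ (G.delta y) f = f y := by
  have h := G.inner_hasSum (G.delta y) f
  have h2 := hasSum_single (f := fun x => (G.m x : ℂ) * (starRingEnd ℂ (G.delta y x) * f x)) y
    (fun x hx => by simp [coe_delta, hx])
  rw [h.unique h2]
  have : (G.m y : ℂ) ≠ 0 := by exact_mod_cast (G.m_pos y).ne'
  simp only [coe_delta, Set.indicator_of_mem, Set.mem_singleton_iff]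
  simp
  field_simp

theorem dense_finSupp : Dense (G.minimalLaplacian.domain : Set G.L2) := by
  refine Submodule.dense_iff_topologicalClosure_eq_top.2
    (Submodule.topologicalClosure_eq_top_iff.2 ?_)
  · rw [Submodule.eq_bot_iff]
    intro f hf
    refine Lp.ext (Eventually.of_forall fun x => ?_)
    rw [coe_zero, ← inner_delta]
    exact hf _ (G.delta_mem x)

/-- The weighted gradient on `C_c(X)`. -/
def gradLM : G.minimalLaplacian.domain →ₗ[ℂ] G.EdgeL2 where
  toFun f := ⟨G.grad f, (memℓp_zero (G.finite_support_grad f.2)).of_exponent_ge (by simp)⟩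
  map_add' f g := by
    ext e
    change G.grad ((f + g : G.L2) : X → ℂ) e = G.grad f e + G.grad g e
    simp only [grad, coe_add, Pi.add_apply]
    ring
  map_smul' c f := by
    ext e
    change G.grad ((c • f : G.L2) : X → ℂ) e = c * G.grad f e
    simp only [grad, coe_smul, Pi.smul_apply, smul_eq_mul]
    ring

theorem gradLM_apply (f : G.minimalLaplacian.domain) (e : X × X) :
    G.gradLM f e = G.grad (f : G.L2) e := rfl

/-- Green's formula on `C_c(X)`. -/
theorem green (f g : G.minimalLaplacian.domain) :
    inner ℂ (G.gradLM f) (G.gradLM g) = inner ℂ (f : G.L2) (G.minimalLaplacian g) := by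
  classical
  have hf : (Function.support (f : X → ℂ)).Finite := f.2
  set F := hf.toFinset ∪ hf.toFinset.biUnion G.nbhd with hF
  set F' := F ∪ (G.finite_support_grad f.2).toFinset.image Prod.fst ∪
    (G.finite_support_grad f.2).toFinset.image Prod.snd with hF'
  have hL : inner ℂ (G.gradLM f) (G.gradLM g) = ∑ x ∈ F', ∑ y ∈ F',
      ((G.b x y : ℂ) / 2) * (starRingEnd ℂ ((f : G.L2) x - (f : G.L2) y) *
        ((g : G.L2) x - (g : G.L2) y)) := by
    rw [lp.inner_eq_tsum, ← Finset.sum_product', tsum_eq_sum (s := F' ×ˢ F')]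
    · refine Finset.sum_congr rfl fun e _ => ?_
      rw [gradLM_apply, gradLM_apply]
      have hs : (√(G.b e.1 e.2 / 2) : ℂ) * (√(G.b e.1 e.2 / 2) : ℂ) = (G.b e.1 e.2 : ℂ) / 2 := by
        rw [← Complex.ofReal_mul, Real.mul_self_sqrt (by have := G.b_nonneg e.1 e.2; positivity)]
        push_cast
        rfl
      rw [← hs]
      simp only [grad, RCLike.inner_apply, map_mul, Complex.conj_ofReal]
      ring
    · intro e he
      have h0 : G.gradLM f e = 0 := by
        by_contra h
        refine he (Finset.mem_product.2 ⟨?_, ?_⟩)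
        · refine Finset.mem_union_left _ (Finset.mem_union_right _ (Finset.mem_image_of_mem _ ?_))
          exact (Set.Finite.mem_toFinset _).2 h
        · refine Finset.mem_union_right _ (Finset.mem_image_of_mem _ ?_)
          exact (Set.Finite.mem_toFinset _).2 h
      rw [h0, inner_zero_left]
  have hR : inner ℂ (f : G.L2) (G.minimalLaplacian g) = ∑ x ∈ F', ∑ y ∈ F',
      (G.b x y : ℂ) * (starRingEnd ℂ ((f : G.L2) x) * ((g : G.L2) x - (g : G.L2) y)) := by
    have hS : (G.minimalLaplacian g : X → ℂ) = G.formalLaplacian (g : G.L2) :=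
      G.eq_of_ae (MemLp.coeFn_toLp
        (G.memLp_of_finite_support (G.finite_support_formalLaplacian g.2)))
    refine (G.inner_hasSum _ _).unique ?_
    rw [hS]
    have h1 : ∀ x, (G.m x : ℂ) * (starRingEnd ℂ ((f : G.L2) x) *
        G.formalLaplacian (g : G.L2) x) = ∑ y ∈ F',
        (G.b x y : ℂ) * (starRingEnd ℂ ((f : G.L2) x) * ((g : G.L2) x - (g : G.L2) y)) := by
      intro x
      by_cases hx : (f : G.L2) x = 0
      · simp [hx]
      have hsub : G.nbhd x ⊆ F' := by
        intro y hy
        refine Finset.mem_union_left _ (Finset.mem_union_left _ (Finset.mem_union_right _ ?_))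
        exact Finset.mem_biUnion.2 ⟨x, (Set.Finite.mem_toFinset _).2 hx, hy⟩
      rw [← Finset.sum_subset hsub]
      · have : (G.m x : ℂ) ≠ 0 := by exact_mod_cast (G.m_pos x).ne'
        simp only [formalLaplacian, Finset.mul_sum]
        refine Finset.sum_congr rfl fun y _ => ?_
        field_simp
      · intro y _ hy
        rw [mem_nbhd] at hy
        have : G.b x y = 0 := le_antisymm (not_lt.1 hy) (G.b_nonneg x y)
        simp [this]
    simp only [h1]
    refine hasSum_sum_of_ne_finset_zero fun x hx => Finset.sum_eq_zero fun y _ => ?_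
    have hx0 : (f : G.L2) x = 0 := by
      by_contra h
      exact hx (Finset.mem_union_left _ (Finset.mem_union_left _ (Finset.mem_union_left _
        ((Set.Finite.mem_toFinset _).2 h))))
    simp [hx0]
  have hR' := hR
  rw [Finset.sum_comm] at hR'
  rw [hL, ← add_halves (inner ℂ (f : G.L2) (G.minimalLaplacian g))]
  nth_rewrite 1 [hR]
  rw [hR', Finset.sum_div, Finset.sum_div, ← Finset.sum_add_distrib]
  refine Finset.sum_congr rfl fun x _ => ?_
  rw [Finset.sum_div, Finset.sum_div, ← Finset.sum_add_distrib]
  refine Finset.sum_congr rfl fun y _ => ?_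
  rw [G.b_symm y x, map_sub]
  ring

theorem continuous_eval (x : X) : Continuous fun f : G.L2 => f x := by
  simp only [← inner_delta]
  exact continuous_const.inner continuous_id

/-- `1 + L` has a bounded everywhere defined right inverse. -/
theorem exists_resolvent : ∃ R : G.L2 →L[ℂ] G.L2,
    ∀ f : G.L2, ∃ h : R f ∈ G.laplacian.domain, R f + G.laplacian ⟨R f, h⟩ = f := by
  let j : G.minimalLaplacian.domain →ₗ[ℂ] WithLp 2 (G.L2 × G.EdgeL2) :=
    (WithLp.linearEquiv 2 ℂ (G.L2 × G.EdgeL2)).symm.toLinearMap ∘ₗ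
      (G.minimalLaplacian.domain.subtype.prod G.gradLM)
  let W := (LinearMap.range j).topologicalClosure
  have : CompleteSpace W := (LinearMap.range j).isClosed_topologicalClosure.completeSpace_coe
  let i : W →L[ℂ] G.L2 := (WithLp.fstL 2 ℂ G.L2 G.EdgeL2).comp W.subtypeL
  have hj : ∀ φ, j φ ∈ W := fun φ => Submodule.le_topologicalClosure _ ⟨φ, rfl⟩
  have key : ∀ (w : W) (φ : G.minimalLaplacian.domain),
      inner ℂ (w : WithLp 2 (G.L2 × G.EdgeL2)) (j φ) =
        inner ℂ (i w) ((φ : G.L2) + G.minimalLaplacian φ) := by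
    rintro ⟨w, hw⟩ φ
    have hcl : IsClosed {w : WithLp 2 (G.L2 × G.EdgeL2) |
        inner ℂ w (j φ) = inner ℂ w.fst ((φ : G.L2) + G.minimalLaplacian φ)} :=
      isClosed_eq (continuous_id.inner continuous_const)
        ((WithLp.fstL 2 ℂ G.L2 G.EdgeL2).continuous.inner continuous_const)
    refine closure_minimal (t := {w : WithLp 2 (G.L2 × G.EdgeL2) |
        inner ℂ w (j φ) = inner ℂ w.fst ((φ : G.L2) + G.minimalLaplacian φ)}) ?_ hcl hw
    rintro _ ⟨ψ, rfl⟩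
    change inner ℂ (j ψ) (j φ) = inner ℂ (ψ : G.L2) ((φ : G.L2) + G.minimalLaplacian φ)
    rw [WithLp.prod_inner_apply, inner_add_right, ← green]
    rfl
  have hform : ∀ w : W, i w ∈ G.formDomain := by
    rintro ⟨w, hw⟩ ε hε
    have hgrad : ∀ e, w.snd e = G.grad w.fst e := by
      intro e
      have hcl : IsClosed {w : WithLp 2 (G.L2 × G.EdgeL2) | w.snd e = G.grad w.fst e} := by
        have c1 := (WithLp.fstL 2 ℂ G.L2 G.EdgeL2).continuous
        have c2 := (WithLp.sndL 2 ℂ G.L2 G.EdgeL2).continuous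
        refine isClosed_eq ((lp.evalCLM ℂ (fun _ : X × X => ℂ) 2 e).continuous.comp c2) ?_
        exact continuous_const.mul (((G.continuous_eval e.1).comp c1).sub
          ((G.continuous_eval e.2).comp c1))
      refine closure_minimal ?_ hcl hw
      rintro _ ⟨ψ, rfl⟩
      rfl
    obtain ⟨δ, hδ, hδε⟩ : ∃ δ : ℝ≥0∞, 0 < δ ∧ δ ^ 2 < ε := by
      obtain ⟨δ, h1, h2⟩ := ENNReal.lt_iff_exists_nnreal_btwn.1 hε
      refine ⟨(NNReal.sqrt δ : ℝ≥0∞), by simpa using h1, ?_⟩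
      rw [← ENNReal.coe_pow, NNReal.sq_sqrt]
      exact h2
    obtain ⟨_, ⟨φ, rfl⟩, hφ⟩ := EMetric.mem_closure_iff.1 hw δ hδ
    refine ⟨φ, φ.2, ?_⟩
    have hE : G.energy ((w.fst - φ : G.L2) : X → ℂ) = ‖w.snd - G.gradLM φ‖ₑ ^ 2 := by
      refine G.energy_eq fun e => ?_
      have hc : ((w.fst - φ : G.L2) : X → ℂ) = w.fst - (φ : G.L2) :=
        G.eq_of_ae (Lp.coeFn_sub _ _)
      rw [lp.coeFn_sub, Pi.sub_apply, hgrad, gradLM_apply, hc]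
      simp only [grad, Pi.sub_apply]
      ring
    have hN : ‖w.fst - φ‖ₑ ^ 2 + ‖w.snd - G.gradLM φ‖ₑ ^ 2 = ‖w - j φ‖ₑ ^ 2 := by
      have := WithLp.prod_norm_sq_eq_of_L2 (w - j φ)
      simp only [← ofReal_norm]
      rw [← ENNReal.ofReal_pow (norm_nonneg _), ← ENNReal.ofReal_pow (norm_nonneg _),
        ← ENNReal.ofReal_pow (norm_nonneg _), ← ENNReal.ofReal_add (by positivity) (by positivity),
        this]
      rfl
    change ‖w.fst - φ‖ₑ ^ 2 + G.energy ((w.fst - φ : G.L2) : X → ℂ) < ε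
    rw [hE, hN, ← edist_eq_enorm_sub]
    exact (pow_le_pow_left' hφ.le 2).trans_lt hδε
  refine ⟨i.comp (ContinuousLinearMap.adjoint i), fun f => ?_⟩
  set w := ContinuousLinearMap.adjoint i f with hw
  have hadj : ∀ φ : G.minimalLaplacian.domain,
      inner ℂ (f - i w) (φ : G.L2) = inner ℂ (i w) (G.minimalLaplacian φ) := by
    intro φ
    have h1 := key w φ
    have h2 : inner ℂ (w : WithLp 2 (G.L2 × G.EdgeL2)) (j φ) = inner ℂ f (φ : G.L2) := by
      have := ContinuousLinearMap.adjoint_inner_left i ⟨j φ, hj φ⟩ f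
      exact this
    rw [h2, inner_add_right] at h1
    rw [inner_sub_left, h1]
    ring
  have hmem : i w ∈ G.minimalLaplacian.adjoint.domain :=
    LinearPMap.mem_adjoint_domain_of_exists _ ⟨_, hadj⟩
  refine ⟨⟨hform w, hmem⟩, ?_⟩
  have h3 : G.laplacian ⟨i w, hform w, hmem⟩ = f - i w :=
    LinearPMap.adjoint_apply_eq G.dense_finSupp ⟨i w, hmem⟩ hadj
  exact (congrArg _ h3).trans (add_sub_cancel _ _)

/-- The bounded operator `(1 + L)⁻¹` on `ℓ²(X,m)`. (As `L` is non-negative, `1 + L` is injective, so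
that exactly one operator has this property.) -/
def resolvent : G.L2 →L[ℂ] G.L2 := Classical.choose G.exists_resolvent

/-- The heat semigroup `e^{-tL}`, `t > 0`, by the functional calculus of the self-adjoint
operator `L`. -/
def heatSemigroup (t : ℝ) : G.L2 →L[ℂ] G.L2 := expNegOfResolvent G.resolvent t

/-- The heat kernel, i.e. the function with `e^{-tL} f(x) = ∑_y p_t(x,y) f(y) m(y)` for all
`f ∈ ℓ²(X,m)`; taking `f = 1_y / m(y)` gives `p_t(x,y) = e^{-tL} (1_y / m(y)) (x)`. This is a real
number, because `e^{-tL}` maps real functions to real functions. -/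
def heatKernel (t : ℝ) (x y : X) : ℝ := (G.heatSemigroup t (G.delta y) x).re

/-- `p_t(x, y_n) → 0` as `y_n → ∞`, that is, along every sequence of vertices that leaves every
finite set eventually. -/
def VanishesAtInfinity (t : ℝ) (x : X) : Prop :=
  Tendsto (fun y => G.heatKernel t x y) cofinite (𝓝 0)

/-- The Feller property: the heat kernel vanishes at infinity, for all vertices and times. -/
def IsFeller : Prop := ∀ x : X, ∀ t : ℝ, 0 < t → G.VanishesAtInfinity t x

end HeatKernel
end WeightedGraph
end

/-!
The heat semigroup is the limit of the implicit Euler scheme, `e^{-tL} f = lim (1 + εL)⁻ⁿ f` with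
`ε = t/n` (`tendsto_eulerOfResolvent_pow`), and one step `u = (1 + εL)⁻¹ f` of the scheme is an
element of the form domain with `u + ε ℒ u = f` pointwise. The maximum principle
`le_of_supersolution` says that such a `u` lies below every non-negative `w` with `w + ε ℒ w ≥ f`,
without any growth condition on `w`. Hence a lower or upper barrier that survives each step of the
scheme yields a bound for the heat kernel, and both parts are the construction of a radial barrier.

For the Feller property the barrier is the decreasing function with `U(r) = D₋(r) (U(r-1) - U(r))`,
that is, `U(r) = ∏_{s ≤ r} (1 + 1/D₋(s))⁻¹`. Outer and horizontal edges contribute non-negatively to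
`ℒ U`, so that `ℒ U + U ≥ 0`, and `U` vanishes at infinity exactly if `∑ 1/D₋(r) = ∞`
(`exists_superharmonic`). It follows that `p_t(x, ·) ≤ C e^{2t} U`.

In the second part, let `a_r` be the summands. The edge weights `E_r` between consecutive spheres
satisfy `E_r ≤ a_r E_{r-1}`, and so both they and the masses of the spheres are summable; therefore
the constants belong to the form domain (`exists_one_mem_formDomain`), which makes the maximum
principle available for constants minus solutions. The function `h = κ ∑_{N < s ≤ r} a_s` is
bounded, small for large `N`, and has `ℒ h ≥ κ` off the ball `B_N` (`exists_radial_lap_ge`): the random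
walk reaches `B_N` from arbitrarily far away within a short time. On `B_N` the solution is at least
some `c > 0` during `[t/2, t]`, since positivity spreads along paths (`exists_eulerStep_pow_ge`).
With `κ = 2/t`, comparison with `c (κ(s - t/2) - h)` for `s ∈ [0, t]` gives `p_t(x, ·) ≥ c/2`
everywhere (`exists_heatKernel_ge`).
-/

/-! ### The form domain and the resolvent -/

namespace WeightedGraph

variable {X : Type*} [MeasurableSpace X] [DiscreteMeasurableSpace X] (G : WeightedGraph X)

theorem coe_sub (f g : G.L2) : ((f - g : G.L2) : X → ℂ) = f - g :=
  G.eq_of_ae (Lp.coeFn_sub f g)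

theorem coe_minimalLaplacian (φ : G.minimalLaplacian.domain) :
    (G.minimalLaplacian φ : X → ℂ) = G.formalLaplacian (φ : G.L2) :=
  G.eq_of_ae (MemLp.coeFn_toLp (G.memLp_of_finite_support (G.finite_support_formalLaplacian φ.2)))

theorem enorm_gradLM_sub_sq_le (f : G.L2) (φ ψ : G.minimalLaplacian.domain) :
    ‖G.gradLM φ - G.gradLM ψ‖ₑ ^ 2 ≤
      2 * G.energy ((f - φ : G.L2) : X → ℂ) + 2 * G.energy ((f - ψ : G.L2) : X → ℂ) := by
  have h1 : G.energy ((ψ - φ : G.L2) : X → ℂ) = ‖G.gradLM ψ - G.gradLM φ‖ₑ ^ 2 := by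
    rw [← map_sub]
    exact G.energy_eq fun e => rfl
  have h2 : ((ψ - φ : G.L2) : X → ℂ) =
      ((f - φ : G.L2) : X → ℂ) + (-1 : ℂ) • ((f - ψ : G.L2) : X → ℂ) := by
    simp only [coe_sub]
    funext x
    simp
  rw [← enorm_neg, neg_sub, ← h1, h2]
  refine (G.energy_add_le _ _).trans_eq ?_
  rw [energy_smul]
  simp

/-- Every element of the form domain has a gradient in `ℓ²(X × X)`, the limit of the gradients of
approximating finitely supported functions. -/
theorem exists_tendsto_gradLM {f : G.L2} (hf : f ∈ G.formDomain) :
    ∃ (z : G.EdgeL2) (φ : ℕ → G.minimalLaplacian.domain),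
      Tendsto (fun n => (φ n : G.L2)) atTop (𝓝 f) ∧
      Tendsto (fun n => G.gradLM (φ n)) atTop (𝓝 z) := by
  have h0 : ∀ n : ℕ, (0 : ℝ≥0∞) < ENNReal.ofReal (1 / ((n : ℝ) + 1)) := fun n =>
    ENNReal.ofReal_pos.2 (by positivity)
  choose φ hφ h using fun n : ℕ => hf _ (h0 n)
  have ht : Tendsto (fun n : ℕ => √(4 * (1 / ((n : ℝ) + 1)))) atTop (𝓝 0) := by
    have := (tendsto_one_div_add_atTop_nhds_zero_nat (𝕜 := ℝ)).const_mul 4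
    rw [mul_zero] at this
    simpa only [Real.sqrt_zero, Function.comp_def] using (Real.continuous_sqrt.tendsto 0).comp this
  have hle : ∀ n : ℕ, ‖f - φ n‖ ≤ √(4 * (1 / ((n : ℝ) + 1))) := by
    intro n
    refine Real.le_sqrt_of_sq_le ?_
    have h1 : ‖f - φ n‖ₑ ^ 2 ≤ ENNReal.ofReal (1 / ((n : ℝ) + 1)) := le_self_add.trans (h n).le
    rw [← ofReal_norm, ← ENNReal.ofReal_pow (norm_nonneg _),
      ENNReal.ofReal_le_ofReal_iff (by positivity)] at h1
    have : 0 < 1 / ((n : ℝ) + 1) := by positivity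
    linarith
  have hc : CauchySeq fun n => G.gradLM ⟨φ n, hφ n⟩ := by
    refine cauchySeq_of_le_tendsto_0 _ (fun n k N hn hk => ?_) ht
    rw [dist_eq_norm]
    refine Real.le_sqrt_of_sq_le ?_
    have hE : ∀ n, N ≤ n → G.energy ((f - φ n : G.L2) : X → ℂ) ≤
        ENNReal.ofReal (1 / ((N : ℝ) + 1)) := fun n hn => by
      refine (le_add_self.trans (h n).le).trans (ENNReal.ofReal_le_ofReal ?_)
      have : (N : ℝ) ≤ n := by exact_mod_cast hn
      gcongr
    have h1 := G.enorm_gradLM_sub_sq_le f ⟨φ n, hφ n⟩ ⟨φ k, hφ k⟩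
    have h2 : ‖G.gradLM ⟨φ n, hφ n⟩ - G.gradLM ⟨φ k, hφ k⟩‖ₑ ^ 2 ≤
        ENNReal.ofReal (4 * (1 / ((N : ℝ) + 1))) := by
      refine h1.trans ((add_le_add (mul_le_mul_right (hE n hn) 2)
        (mul_le_mul_right (hE k hk) 2)).trans_eq ?_)
      rw [ENNReal.ofReal_mul (by norm_num), ← add_mul, ENNReal.ofReal_ofNat]
      norm_num
    rwa [← ofReal_norm, ← ENNReal.ofReal_pow (norm_nonneg _),
      ENNReal.ofReal_le_ofReal_iff (by positivity)] at h2
  obtain ⟨z, hz⟩ := cauchySeq_tendsto_of_complete hc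
  refine ⟨z, fun n => ⟨φ n, hφ n⟩, ?_, hz⟩
  rw [tendsto_iff_norm_sub_tendsto_zero]
  refine squeeze_zero (fun _ => norm_nonneg _) (fun n => ?_) ht
  rw [norm_sub_rev]
  exact hle n

theorem green_formDomain {v : G.L2} {z : G.EdgeL2} {φ : ℕ → G.minimalLaplacian.domain}
    (h1 : Tendsto (fun n => (φ n : G.L2)) atTop (𝓝 v))
    (h2 : Tendsto (fun n => G.gradLM (φ n)) atTop (𝓝 z)) (ψ : G.minimalLaplacian.domain) :
    inner ℂ z (G.gradLM ψ) = inner ℂ v (G.minimalLaplacian ψ) := by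
  refine tendsto_nhds_unique (h2.inner tendsto_const_nhds) ?_
  simp only [green]
  exact h1.inner tendsto_const_nhds

theorem inner_laplacian (u : G.laplacian.domain) (ψ : G.minimalLaplacian.domain) :
    inner ℂ (G.laplacian u) (ψ : G.L2) = inner ℂ (u : G.L2) (G.minimalLaplacian ψ) :=
  LinearPMap.adjoint_isFormalAdjoint G.dense_finSupp ⟨u, u.2.2⟩ ψ

/-- Green's formula `⟪u, L v⟫ = Q(u, v)` for `u` in the form domain and `v` in the domain
of `L`; the form is represented by the gradients `z`, `z'` of `u` and `v`. -/
theorem inner_laplacian_eq_inner_grad {u : G.L2} {v : G.laplacian.domain} {z z' : G.EdgeL2}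
    {φ φ' : ℕ → G.minimalLaplacian.domain}
    (h1 : Tendsto (fun n => (φ n : G.L2)) atTop (𝓝 u))
    (h2 : Tendsto (fun n => G.gradLM (φ n)) atTop (𝓝 z))
    (h1' : Tendsto (fun n => (φ' n : G.L2)) atTop (𝓝 (v : G.L2)))
    (h2' : Tendsto (fun n => G.gradLM (φ' n)) atTop (𝓝 z')) :
    inner ℂ (G.laplacian v) u = inner ℂ z' z := by
  refine tendsto_nhds_unique ((tendsto_const_nhds (x := G.laplacian v)).inner h1) ?_
  simp only [inner_laplacian, ← G.green_formDomain h1' h2']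
  exact tendsto_const_nhds.inner h2

/-- The Friedrichs extension is given by the formal Laplacian. -/
theorem coe_laplacian (u : G.laplacian.domain) :
    (G.laplacian u : X → ℂ) = G.formalLaplacian (u : G.L2) := by
  classical
  funext x
  -- the adjoint is evaluated at `x` by testing it with `δ_x`
  have h := G.inner_laplacian u ⟨G.delta x, G.delta_mem x⟩
  rw [← inner_conj_symm, inner_delta] at h
  have h2 := (G.inner_hasSum (u : G.L2) (G.minimalLaplacian ⟨G.delta x, G.delta_mem x⟩))
  rw [← h, coe_minimalLaplacian] at h2
  have h3 : ∀ y ∉ insert x (G.nbhd x), (G.m y : ℂ) * (starRingEnd ℂ ((u : G.L2) y) *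
      G.formalLaplacian (G.delta x : X → ℂ) y) = 0 := by
    intro y hy
    rw [Finset.mem_insert, not_or] at hy
    simp only [formalLaplacian, coe_delta]
    rw [Finset.sum_eq_zero]
    · simp
    · intro z hz
      have hzx : z ≠ x := by
        rintro rfl
        exact hy.2 (G.mem_nbhd.2 (by rw [G.b_symm]; exact G.mem_nbhd.1 hz))
      simp [hy.1, hzx]
  have h4 := h2.unique (hasSum_sum_of_ne_finset_zero h3)
  have hx : x ∉ G.nbhd x := by simp [mem_nbhd, G.b_self]
  have hm : ∀ y, (G.m y : ℂ) ≠ 0 := fun y => by exact_mod_cast (G.m_pos y).ne'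
  have h5 : ∀ y ∈ G.nbhd x, (G.m y : ℂ) * (starRingEnd ℂ ((u : G.L2) y) *
      G.formalLaplacian (G.delta x : X → ℂ) y) =
      -((1 / (G.m x : ℂ)) * ((G.b x y : ℂ) * starRingEnd ℂ ((u : G.L2) y))) := by
    intro y hy
    have hyx : y ≠ x := fun h => hx (h ▸ hy)
    have hy' : x ∈ G.nbhd y := G.mem_nbhd.2 (by rw [G.b_symm]; exact G.mem_nbhd.1 hy)
    simp only [formalLaplacian, coe_delta]
    rw [Finset.sum_eq_single_of_mem x hy']
    · simp [hyx, G.b_symm y x]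
      field_simp [hm y]
    · intro z _ hz
      simp [hyx, hz]
  have h6 : (G.m x : ℂ) * (starRingEnd ℂ ((u : G.L2) x) *
      G.formalLaplacian (G.delta x : X → ℂ) x) =
      ∑ y ∈ G.nbhd x, (1 / (G.m x : ℂ)) * ((G.b x y : ℂ) * starRingEnd ℂ ((u : G.L2) x)) := by
    simp only [formalLaplacian, coe_delta, Finset.mul_sum]
    refine Finset.sum_congr rfl fun y hy => ?_
    have hyx : y ≠ x := fun h => hx (h ▸ hy)
    simp [hyx]
    field_simp [hm x]
  rw [Finset.sum_insert hx, h6, Finset.sum_congr rfl h5, ← Finset.sum_add_distrib] at h4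
  have h7 := congrArg (starRingEnd ℂ) h4
  rw [RCLike.conj_conj] at h7
  change G.laplacian u x = _ at h7
  rw [h7]
  simp only [formalLaplacian, map_sum, Finset.mul_sum]
  refine Finset.sum_congr rfl fun y _ => ?_
  simp
  ring

theorem resolvent_mem (f : G.L2) : G.resolvent f ∈ G.laplacian.domain :=
  (Classical.choose_spec G.exists_resolvent f).1

theorem resolvent_add_laplacian (f : G.L2) :
    G.resolvent f + G.laplacian ⟨G.resolvent f, G.resolvent_mem f⟩ = f :=
  (Classical.choose_spec G.exists_resolvent f).2

theorem resolvent_mem_formDomain (f : G.L2) : G.resolvent f ∈ G.formDomain :=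
  (G.resolvent_mem f).1

theorem formalLaplacian_resolvent (f : G.L2) (x : X) :
    G.formalLaplacian (G.resolvent f : X → ℂ) x = f x - G.resolvent f x := by
  have h := G.coe_laplacian ⟨G.resolvent f, G.resolvent_mem f⟩
  have h2 : G.laplacian ⟨G.resolvent f, G.resolvent_mem f⟩ = f - G.resolvent f := by
    rw [eq_sub_iff_add_eq, add_comm]; exact G.resolvent_add_laplacian f
  rw [h2, coe_sub] at h
  exact (congrFun h x).symm

/-- `⟪f, (1 + L)⁻¹ g⟫ = ⟪u, v⟫ + Q(u, v)` with `u = (1 + L)⁻¹ f` and `v = (1 + L)⁻¹ g`. -/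
theorem exists_inner_resolvent : ∃ z : G.L2 → G.EdgeL2, ∀ f g : G.L2,
    inner ℂ f (G.resolvent g) =
      inner ℂ (G.resolvent f) (G.resolvent g) + inner ℂ (z f) (z g) := by
  choose z φ h1 h2 using fun f : G.L2 => G.exists_tendsto_gradLM (G.resolvent_mem_formDomain f)
  refine ⟨z, fun f g => ?_⟩
  nth_rewrite 1 [← G.resolvent_add_laplacian f]
  rw [inner_add_left, G.inner_laplacian_eq_inner_grad (h1 g) (h2 g) (h1 f) (h2 f)]

theorem isSelfAdjoint_resolvent : IsSelfAdjoint G.resolvent := by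
  obtain ⟨z, hz⟩ := G.exists_inner_resolvent
  rw [ContinuousLinearMap.isSelfAdjoint_iff_isSymmetric]
  intro f g
  change inner ℂ (G.resolvent f) g = inner ℂ f (G.resolvent g)
  rw [← inner_conj_symm, hz g f, hz f g, map_add, inner_conj_symm, inner_conj_symm]

theorem re_inner_resolvent (f : G.L2) :
    ‖G.resolvent f‖ ^ 2 ≤ (inner ℂ f (G.resolvent f)).re := by
  obtain ⟨z, hz⟩ := G.exists_inner_resolvent
  rw [hz f f, Complex.add_re]
  have h1 : (inner ℂ (G.resolvent f) (G.resolvent f)).re = ‖G.resolvent f‖ ^ 2 :=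
    inner_self_eq_norm_sq (𝕜 := ℂ) _
  have h2 : 0 ≤ (inner ℂ (z f) (z f)).re := inner_self_nonneg (𝕜 := ℂ)
  linarith

theorem resolvent_nonneg : 0 ≤ G.resolvent := by
  rw [ContinuousLinearMap.nonneg_iff_isPositive, ContinuousLinearMap.isPositive_def]
  refine ⟨G.isSelfAdjoint_resolvent.isSymmetric, fun f => ?_⟩
  rw [ContinuousLinearMap.reApplyInnerSelf_apply, inner_re_symm]
  exact (sq_nonneg _).trans (G.re_inner_resolvent f)

theorem norm_resolvent_le : ‖G.resolvent‖ ≤ 1 := by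
  refine ContinuousLinearMap.opNorm_le_bound _ zero_le_one fun f => ?_
  have h1 := G.re_inner_resolvent f
  have h2 : (inner ℂ f (G.resolvent f)).re ≤ ‖f‖ * ‖G.resolvent f‖ := re_inner_le_norm (𝕜 := ℂ) _ _
  by_contra h
  nlinarith [norm_nonneg (G.resolvent f), norm_nonneg f]

theorem spectrum_resolvent_subset : spectrum ℝ G.resolvent ⊆ Set.Icc 0 1 := by
  intro s hs
  refine ⟨spectrum_nonneg_of_nonneg G.resolvent_nonneg hs, ?_⟩
  have h1 := spectrum.norm_le_norm_mul_of_mem hs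
  have h2 : ‖(1 : G.L2 →L[ℂ] G.L2)‖ ≤ 1 := ContinuousLinearMap.norm_id_le
  have h3 : ‖s‖ ≤ 1 := h1.trans (mul_le_one₀ G.norm_resolvent_le (norm_nonneg _) h2)
  exact (le_abs_self s).trans h3

end WeightedGraph

/-! ### The implicit Euler scheme for the heat equation -/


theorem euler_denom_pos {ε s : ℝ} (hε : 0 < ε) (h0 : 0 ≤ s) (h1 : s ≤ 1) :
    0 < s + ε * (1 - s) := by
  rcases h0.eq_or_lt with rfl | h
  · simpa using hε
  · have := mul_nonneg hε.le (sub_nonneg.2 h1)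
    linarith

theorem continuousOn_euler {ε : ℝ} (hε : 0 < ε) :
    ContinuousOn (fun s : ℝ => s / (s + ε * (1 - s))) (Set.Icc 0 1) :=
  ContinuousOn.div (by fun_prop) (by fun_prop) fun _ hs => (euler_denom_pos hε hs.1 hs.2).ne'

theorem antitone_euler {t s : ℝ} (ht : 0 < t) (h0 : 0 ≤ s) (h1 : s ≤ 1) :
    Antitone fun j : ℕ => (s / (s + t / 2 ^ j * (1 - s))) ^ 2 ^ j := by
  refine antitone_nat_of_succ_le fun j => ?_
  have hε : 0 < t / 2 ^ j := by positivity
  have e : t / 2 ^ (j + 1) = t / 2 ^ j / 2 := by rw [pow_succ]; field_simp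
  rw [e, pow_succ' 2 j, pow_mul]
  set ε := t / 2 ^ j
  have hd := euler_denom_pos hε h0 h1
  have hd2 := euler_denom_pos (half_pos hε) h0 h1
  refine pow_le_pow_left₀ (sq_nonneg _) ?_ _
  rw [div_pow, div_le_div_iff₀ (pow_pos hd2 2) hd]
  have := mul_nonneg h0 (sq_nonneg (ε / 2 * (1 - s)))
  nlinarith [sq_nonneg (ε / 2 * (1 - s))]

theorem tendsto_euler (t : ℝ) {s : ℝ} (h0 : 0 ≤ s) :
    Tendsto (fun j : ℕ => (s / (s + t / 2 ^ j * (1 - s))) ^ 2 ^ j) atTop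
      (𝓝 (if s ≤ 0 then 0 else Real.exp (-t * (1 / s - 1)))) := by
  rcases h0.eq_or_lt with rfl | h
  · simp
  rw [if_neg h.not_ge, neg_mul, Real.exp_neg]
  have h2 : Tendsto (fun j : ℕ => 2 ^ j) atTop atTop :=
    tendsto_pow_atTop_atTop_of_one_lt (one_lt_two : 1 < (2 : ℕ))
  have h3 := ((Real.tendsto_one_add_div_pow_exp (t * (1 / s - 1))).comp h2).inv₀
    (Real.exp_ne_zero _)
  refine h3.congr fun j => ?_
  simp only [Function.comp, ← inv_pow]
  congr 1
  push_cast
  field_simp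

theorem continuousOn_exp_resolvent {t : ℝ} (ht : 0 < t) :
    ContinuousOn (fun s : ℝ => if s ≤ 0 then 0 else Real.exp (-t * (1 / s - 1)))
      (Set.Icc 0 1) := by
  intro s hs
  rcases hs.1.eq_or_lt with rfl | h
  · have hF := (continuousOn_euler ht) 0 hs
    -- at `0` the function is squeezed by the single Euler step that lies above it
    unfold ContinuousWithinAt at hF ⊢
    simp only [zero_div, le_refl, if_true] at hF ⊢
    refine squeeze_zero' ?_ ?_ hF
    · filter_upwards with s
      split_ifs <;> positivity
    · filter_upwards [self_mem_nhdsWithin] with s hs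
      have h1 := (antitone_euler ht hs.1 hs.2).le_of_tendsto (tendsto_euler t hs.1) 0
      simpa using h1
  · refine ContinuousAt.continuousWithinAt ?_
    have h1 : (fun s : ℝ => Real.exp (-t * (1 / s - 1))) =ᶠ[𝓝 s]
        fun s : ℝ => if s ≤ 0 then 0 else Real.exp (-t * (1 / s - 1)) := by
      filter_upwards [lt_mem_nhds h] with r hr
      rw [if_neg hr.not_ge]
    refine ContinuousAt.congr ?_ h1
    have := h.ne'
    fun_prop (disch := assumption)

section Hilbert

variable {H : Type*} [NormedAddCommGroup H] [InnerProductSpace ℂ H] [CompleteSpace H]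

/-- One step `(1 + εA)⁻¹` of the implicit Euler scheme, as the function `s ↦ s / (s + ε(1 - s))` of
`R = (1 + A)⁻¹`; indeed `s / (s + ε(1 - s)) = 1 / (1 + ελ)` for `s = 1 / (1 + λ)`. -/
noncomputable def eulerOfResolvent (R : H →L[ℂ] H) (ε : ℝ) : H →L[ℂ] H :=
  cfc (fun s : ℝ => s / (s + ε * (1 - s))) R

theorem smul_eulerOfResolvent {R : H →L[ℂ] H} (ha : IsSelfAdjoint R)
    (hR : spectrum ℝ R ⊆ Set.Icc 0 1) {ε : ℝ} (hε : 0 < ε) :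
    ε • eulerOfResolvent R ε = R * (1 - (1 - ε) • eulerOfResolvent R ε) := by
  have hc : ContinuousOn (fun s : ℝ => s / (s + ε * (1 - s))) (spectrum ℝ R) :=
    (continuousOn_euler hε).mono hR
  have h1 : ε • eulerOfResolvent R ε = cfc (fun s : ℝ => ε • (s / (s + ε * (1 - s)))) R :=
    (cfc_smul ε _ _ hc).symm
  have h2 : (1 - ε) • eulerOfResolvent R ε =
      cfc (fun s : ℝ => (1 - ε) • (s / (s + ε * (1 - s)))) R :=
    (cfc_smul (1 - ε) _ _ hc).symm
  have hc2 : ContinuousOn (fun s : ℝ => (1 - ε) • (s / (s + ε * (1 - s)))) (spectrum ℝ R) :=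
    hc.const_smul (1 - ε)
  have hc3 : ContinuousOn (fun s : ℝ => 1 - (1 - ε) • (s / (s + ε * (1 - s)))) (spectrum ℝ R) :=
    continuousOn_const.sub hc2
  have h3 : 1 - (1 - ε) • eulerOfResolvent R ε =
      cfc (fun s : ℝ => 1 - (1 - ε) • (s / (s + ε * (1 - s)))) R := by
    rw [h2, cfc_sub _ _ _ (by fun_prop) hc2, cfc_const_one ℝ R]
  rw [h1, h3]
  nth_rewrite 2 [← cfc_id' ℝ R]
  rw [← cfc_mul _ _ _ (by fun_prop) hc3]
  refine cfc_congr fun s hs => ?_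
  have hs' := hR hs
  have := (euler_denom_pos hε hs'.1 hs'.2).ne'
  simp only [smul_eq_mul]
  field_simp
  ring

theorem eulerOfResolvent_apply {R : H →L[ℂ] H} (ha : IsSelfAdjoint R)
    (hR : spectrum ℝ R ⊆ Set.Icc 0 1) {ε : ℝ} (hε : 0 < ε) (f : H) :
    eulerOfResolvent R ε f =
      R ((ε : ℂ)⁻¹ • (f - (1 - ε : ℂ) • eulerOfResolvent R ε f)) := by
  have h := congrArg (fun T : H →L[ℂ] H => T f) (smul_eulerOfResolvent ha hR hε)
  simp only [smul_apply, mul_apply_eq_comp, sub_apply,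
    one_apply_eq_self] at h
  rw [← Complex.coe_smul, ← Complex.coe_smul] at h
  push_cast at h
  rw [map_smul, ← h, smul_smul, inv_mul_cancel₀ (by exact_mod_cast hε.ne'), one_smul]

/-- The implicit Euler scheme converges in norm, `(1 + (t/n) A)⁻ⁿ → e^{-tA}`. Along the powers
`n = 2 ^ j` the convergence of the corresponding functions on the spectrum is monotone, and so it
is uniform by Dini's theorem. -/
theorem tendsto_eulerOfResolvent_pow {R : H →L[ℂ] H} (ha : IsSelfAdjoint R)
    (hR : spectrum ℝ R ⊆ Set.Icc 0 1) {t : ℝ} (ht : 0 < t) :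
    Tendsto (fun j : ℕ => eulerOfResolvent R (t / 2 ^ j) ^ 2 ^ j) atTop
      (𝓝 (expNegOfResolvent R t)) := by
  have hc : ∀ j : ℕ, ContinuousOn (fun s : ℝ => s / (s + t / 2 ^ j * (1 - s))) (Set.Icc 0 1) :=
    fun j => continuousOn_euler (by positivity)
  have hu : TendstoUniformlyOn (fun (j : ℕ) (s : ℝ) => (s / (s + t / 2 ^ j * (1 - s))) ^ 2 ^ j)
      (fun s : ℝ => if s ≤ 0 then 0 else Real.exp (-t * (1 / s - 1))) atTop (Set.Icc 0 1) :=
    Antitone.tendstoUniformlyOn_of_forall_tendsto isCompact_Icc (fun j => (hc j).pow _)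
      (fun s hs => antitone_euler ht hs.1 hs.2) (continuousOn_exp_resolvent ht)
      (fun s hs => tendsto_euler t hs.1)
  have h := tendsto_cfc_fun (a := R) (hu.mono hR)
    (Eventually.of_forall fun j => ((hc j).pow _).mono hR)
  refine h.congr fun j => ?_
  exact cfc_pow _ _ _ ((hc j).mono hR) ha

theorem isSelfAdjoint_expNegOfResolvent (R : H →L[ℂ] H) (t : ℝ) :
    IsSelfAdjoint (expNegOfResolvent R t) :=
  cfc_predicate _ _

end Hilbert

namespace WeightedGraph

variable {X : Type*} [MeasurableSpace X] [DiscreteMeasurableSpace X] (G : WeightedGraph X)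

/-- One step `(1 + εL)⁻¹` of the implicit Euler scheme for the heat equation of the graph. -/
noncomputable def eulerStep (ε : ℝ) : G.L2 →L[ℂ] G.L2 := eulerOfResolvent G.resolvent ε

theorem eulerStep_eq_resolvent {ε : ℝ} (hε : 0 < ε) (f : G.L2) :
    G.eulerStep ε f = G.resolvent ((ε : ℂ)⁻¹ • (f - (1 - ε : ℂ) • G.eulerStep ε f)) :=
  eulerOfResolvent_apply G.isSelfAdjoint_resolvent G.spectrum_resolvent_subset hε f

theorem eulerStep_mem_formDomain {ε : ℝ} (hε : 0 < ε) (f : G.L2) :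
    G.eulerStep ε f ∈ G.formDomain := by
  rw [eulerStep_eq_resolvent G hε]
  exact G.resolvent_mem_formDomain _

theorem eulerStep_eq {ε : ℝ} (hε : 0 < ε) (f : G.L2) (x : X) :
    G.eulerStep ε f x + ε * G.formalLaplacian (G.eulerStep ε f : X → ℂ) x = f x := by
  have h := G.formalLaplacian_resolvent ((ε : ℂ)⁻¹ • (f - (1 - ε : ℂ) • G.eulerStep ε f)) x
  rw [← eulerStep_eq_resolvent G hε, coe_smul, Pi.smul_apply, coe_sub,
    Pi.sub_apply, coe_smul, Pi.smul_apply] at h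
  rw [h]
  have : (ε : ℂ) ≠ 0 := by exact_mod_cast hε.ne'
  simp only [smul_eq_mul]
  field_simp
  ring

theorem tendsto_eulerStep_pow_apply {t : ℝ} (ht : 0 < t) (f : G.L2) (x : X) :
    Tendsto (fun j : ℕ => ((G.eulerStep (t / 2 ^ j) ^ 2 ^ j) f x).re) atTop
      (𝓝 (G.heatSemigroup t f x).re) := by
  have h : Continuous fun T : G.L2 →L[ℂ] G.L2 => (T f x).re :=
    Complex.continuous_re.comp
      ((G.continuous_eval x).comp (ContinuousLinearMap.apply ℂ G.L2 f).continuous)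
  exact (h.tendsto _).comp (tendsto_eulerOfResolvent_pow G.isSelfAdjoint_resolvent
    G.spectrum_resolvent_subset ht)

theorem heatKernel_symm (t : ℝ) (x y : X) : G.heatKernel t x y = G.heatKernel t y x := by
  have h := isSelfAdjoint_expNegOfResolvent G.resolvent t
  rw [ContinuousLinearMap.isSelfAdjoint_iff_isSymmetric] at h
  have h2 : inner ℂ (G.heatSemigroup t (G.delta x)) (G.delta y) =
      inner ℂ (G.delta x) (G.heatSemigroup t (G.delta y)) := h (G.delta x) (G.delta y)
  rw [← inner_conj_symm, inner_delta, inner_delta] at h2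
  rw [heatKernel, heatKernel, ← h2, Complex.conj_re]

end WeightedGraph

/-! ### The maximum principle -/

namespace WeightedGraph

section Real

variable {X : Type*} (G : WeightedGraph X)

/-- The formal Laplacian `(1/m(x)) ∑_y b(x,y) (f(x) - f(y))` of a real function. -/
noncomputable def lap (f : X → ℝ) (x : X) : ℝ :=
  (1 / G.m x) * ∑ y ∈ G.nbhd x, G.b x y * (f x - f y)

theorem re_formalLaplacian (u : X → ℂ) (x : X) :
    (G.formalLaplacian u x).re = G.lap (fun y => (u y).re) x := by
  have h : (1 / (G.m x : ℂ)) = ((1 / G.m x : ℝ) : ℂ) := by push_cast; rfl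
  simp only [formalLaplacian, lap]
  rw [h, Complex.re_ofReal_mul, Complex.re_sum]
  simp only [Complex.re_ofReal_mul, Complex.sub_re]

theorem lap_const_sub (C : ℝ) (f : X → ℝ) (x : X) :
    G.lap (fun y => C - f y) x = -G.lap f x := by
  simp only [lap]
  rw [← mul_neg, ← Finset.sum_neg_distrib]
  congr 1
  exact Finset.sum_congr rfl fun y _ => by ring

theorem lap_const_mul (C : ℝ) (f : X → ℝ) (x : X) :
    G.lap (fun y => C * f y) x = C * G.lap f x := by
  simp only [lap, Finset.mul_sum]
  exact Finset.sum_congr rfl fun y _ => by ring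

theorem lap_const (C : ℝ) (x : X) : G.lap (fun _ => C) x = 0 := by
  simp [lap]

theorem lap_sub (f g : X → ℝ) (x : X) :
    G.lap (fun y => f y - g y) x = G.lap f x - G.lap g x := by
  simp only [lap, ← mul_sub, ← Finset.sum_sub_distrib]
  congr 1
  exact Finset.sum_congr rfl fun y _ => by ring

theorem lap_le_lap {f g : X → ℝ} {x : X} (hx : f x = g x) (h : ∀ y, g y ≤ f y) :
    G.lap f x ≤ G.lap g x := by
  have := G.m_pos x
  unfold lap
  gcongr with y
  · exact G.b_nonneg x y
  · exact hx.le
  · exact h y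

theorem m_mul_lap (f : X → ℝ) (x : X) {F : Finset X} (hF : G.nbhd x ⊆ F) :
    G.m x * G.lap f x = ∑ y ∈ F, G.b x y * (f x - f y) := by
  rw [lap, ← mul_assoc, mul_one_div_cancel (G.m_pos x).ne', one_mul]
  refine Finset.sum_subset hF fun y _ hy => ?_
  rw [mem_nbhd] at hy
  rw [le_antisymm (not_lt.1 hy) (G.b_nonneg x y), zero_mul]

/-- Green's formula for a function `ψ` that vanishes off a finite set and an arbitrary `f`. -/
theorem sum_mul_lap {f ψ : X → ℝ} {F : Finset X} (hF : ∀ x, ψ x ≠ 0 → x ∈ F ∧ G.nbhd x ⊆ F) :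
    ∑ x ∈ F, G.m x * (ψ x * G.lap f x) =
      (1 / 2) * ∑ x ∈ F, ∑ y ∈ F, G.b x y * ((f x - f y) * (ψ x - ψ y)) := by
  have h1 : ∑ x ∈ F, G.m x * (ψ x * G.lap f x) =
      ∑ x ∈ F, ∑ y ∈ F, G.b x y * ((f x - f y) * ψ x) := by
    refine Finset.sum_congr rfl fun x _ => ?_
    by_cases hx : ψ x = 0
    · simp [hx]
    · rw [mul_left_comm, G.m_mul_lap f x (hF x hx).2, Finset.mul_sum]
      exact Finset.sum_congr rfl fun y _ => by ring
  -- the average of the double sum and of the same sum with `x` and `y` exchanged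
  have h2 := h1
  rw [Finset.sum_comm] at h2
  have h3 : ∑ x ∈ F, G.m x * (ψ x * G.lap f x) = (1 / 2) *
      (∑ x ∈ F, G.m x * (ψ x * G.lap f x) + ∑ x ∈ F, G.m x * (ψ x * G.lap f x)) := by ring
  rw [h3]
  nth_rewrite 1 [h1]
  rw [h2, ← Finset.sum_add_distrib]
  congr 1
  refine Finset.sum_congr rfl fun x _ => ?_
  rw [← Finset.sum_add_distrib]
  refine Finset.sum_congr rfl fun y _ => ?_
  rw [G.b_symm y x]
  ring

/-- The quantitative maximum principle behind `le_of_supersolution`: `a` is a subsolution, `w` a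
non-negative supersolution, and `φ` a finitely supported function that is `√δ`-close to `a` in the
form norm. Testing the inequality with `(φ - w)₊` bounds this function by `√((1 + ε) δ)`. -/
theorem m_mul_sq_le_of_approx {ε δ : ℝ} (hε : 0 < ε) {a w φ : X → ℝ} (hw : ∀ x, 0 ≤ w x)
    (h : ∀ x, a x + ε * G.lap a x ≤ w x + ε * G.lap w x) (hφ : (Function.support φ).Finite)
    (h1 : ∀ S : Finset X, ∑ x ∈ S, G.m x * (a x - φ x) ^ 2 ≤ δ)
    (h2 : ∀ S : Finset X, (1 / 2) *
      ∑ x ∈ S, ∑ y ∈ S, G.b x y * ((a x - φ x) - (a y - φ y)) ^ 2 ≤ δ) (x : X) :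
    G.m x * (max (φ x - w x) 0) ^ 2 ≤ (1 + ε) * δ := by
  classical
  set ψ : X → ℝ := fun x => max (φ x - w x) 0 with hψ
  have hψ0 : ∀ x, 0 ≤ ψ x := fun x => le_max_right _ _
  set F : Finset X := insert x (hφ.toFinset ∪ hφ.toFinset.biUnion G.nbhd) with hFdef
  have hF : ∀ x, ψ x ≠ 0 → x ∈ F ∧ G.nbhd x ⊆ F := by
    intro z hz
    have hz' : z ∈ hφ.toFinset := by
      rw [Set.Finite.mem_toFinset, Function.mem_support]
      intro h0
      refine hz (max_eq_right ?_)
      rw [h0, zero_sub]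
      exact neg_nonpos.2 (hw z)
    refine ⟨Finset.mem_insert_of_mem (Finset.mem_union_left _ hz'), fun y hy => ?_⟩
    exact Finset.mem_insert_of_mem (Finset.mem_union_right _ (Finset.mem_biUnion.2 ⟨z, hz', hy⟩))
  have e1 : ∑ x ∈ F, G.m x * (ψ x * (a x - w x)) +
      ε * ∑ x ∈ F, G.m x * (ψ x * G.lap (fun y => a y - w y) x) ≤ 0 := by
    rw [Finset.mul_sum, ← Finset.sum_add_distrib]
    refine Finset.sum_nonpos fun z _ => ?_
    rw [lap_sub]
    have h3 : (a z - w z) + ε * (G.lap a z - G.lap w z) ≤ 0 := by linarith [h z]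
    have h4 := mul_nonpos_of_nonneg_of_nonpos (mul_nonneg (G.m_pos z).le (hψ0 z)) h3
    linarith
  rw [G.sum_mul_lap hF] at e1
  -- writing `a - w = (φ - w) + (a - φ)`, the part with `φ - w` is bounded below by squares of `ψ`,
  -- which absorb the part with `a - φ` by the inequality of the means
  have e2 : (1 / 2) * ∑ x ∈ F, G.m x * ψ x ^ 2 - (1 / 2) * ∑ x ∈ F, G.m x * (a x - φ x) ^ 2 ≤
      ∑ x ∈ F, G.m x * (ψ x * (a x - w x)) := by
    rw [Finset.mul_sum, Finset.mul_sum, ← Finset.sum_sub_distrib]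
    refine Finset.sum_le_sum fun z _ => ?_
    have h3 : ψ z * (φ z - w z) = ψ z ^ 2 := by
      rcases max_cases (φ z - w z) 0 with h4 | h4 <;> simp only [hψ, h4.1] <;> ring
    have h4 : (1 / 2) * ψ z ^ 2 - (1 / 2) * (a z - φ z) ^ 2 ≤ ψ z * (a z - w z) := by
      nlinarith [sq_nonneg (ψ z + (a z - φ z))]
    have := mul_le_mul_of_nonneg_left h4 (G.m_pos z).le
    linarith
  have e3 : -((1 / 2) * ∑ x ∈ F, ∑ y ∈ F, G.b x y * ((a x - φ x) - (a y - φ y)) ^ 2) ≤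
      ∑ x ∈ F, ∑ y ∈ F, G.b x y * (((a x - w x) - (a y - w y)) * (ψ x - ψ y)) := by
    rw [Finset.mul_sum, ← Finset.sum_neg_distrib]
    refine Finset.sum_le_sum fun z _ => ?_
    rw [Finset.mul_sum, ← Finset.sum_neg_distrib]
    refine Finset.sum_le_sum fun y _ => ?_
    have h3 : (ψ z - ψ y) ^ 2 ≤ ((φ z - w z) - (φ y - w y)) * (ψ z - ψ y) := by
      rcases max_cases (φ z - w z) 0 with h4 | h4 <;>
        rcases max_cases (φ y - w y) 0 with h5 | h5 <;> simp only [hψ, h4.1, h5.1] <;> nlinarith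
    have h4 : -((1 / 2) * ((a z - φ z) - (a y - φ y)) ^ 2) ≤
        ((a z - w z) - (a y - w y)) * (ψ z - ψ y) := by
      nlinarith [sq_nonneg ((ψ z - ψ y) + ((a z - φ z) - (a y - φ y))), sq_nonneg (ψ z - ψ y)]
    have := mul_le_mul_of_nonneg_left h4 (G.b_nonneg z y)
    linarith
  have e4 : G.m x * ψ x ^ 2 ≤ ∑ x ∈ F, G.m x * ψ x ^ 2 :=
    Finset.single_le_sum (f := fun x => G.m x * ψ x ^ 2)
      (fun z _ => mul_nonneg (G.m_pos z).le (sq_nonneg _)) (Finset.mem_insert_self _ _)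
  have e5 := h1 F
  have e6 := mul_le_mul_of_nonneg_left (h2 F) hε.le
  have e7 := mul_le_mul_of_nonneg_left e3 hε.le
  linarith

theorem sum_b_mul_norm_sq_le {f : X → ℂ} {δ : ℝ} (hδ : 0 ≤ δ)
    (h : G.energy f ≤ ENNReal.ofReal δ) (S : Finset X) :
    (1 / 2) * ∑ x ∈ S, ∑ y ∈ S, G.b x y * ‖f x - f y‖ ^ 2 ≤ δ := by
  have hnn : ∀ x y, 0 ≤ G.b x y * ‖f x - f y‖ ^ 2 := fun x y =>
    mul_nonneg (G.b_nonneg x y) (sq_nonneg _)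
  rw [← ENNReal.ofReal_le_ofReal_iff hδ]
  refine le_trans ?_ h
  rw [ENNReal.ofReal_mul (by norm_num), energy]
  have h2 : ENNReal.ofReal (1 / 2) = 1 / 2 := by
    rw [ENNReal.ofReal_div_of_pos (by norm_num)]; simp
  rw [h2]
  gcongr
  rw [ENNReal.ofReal_sum_of_nonneg fun x _ => Finset.sum_nonneg fun y _ => hnn x y]
  refine le_trans ?_ (ENNReal.sum_le_tsum S)
  refine Finset.sum_le_sum fun x _ => ?_
  rw [ENNReal.ofReal_sum_of_nonneg fun y _ => hnn x y]
  refine le_trans ?_ (ENNReal.sum_le_tsum S)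
  refine Finset.sum_le_sum fun y _ => ?_
  rw [ENNReal.ofReal_mul (G.b_nonneg x y), ENNReal.ofReal_pow (norm_nonneg _), ofReal_norm]

end Real

variable {X : Type*} [MeasurableSpace X] [DiscreteMeasurableSpace X] (G : WeightedGraph X)

theorem hasSum_m_mul_norm_sq (f : G.L2) : HasSum (fun x => G.m x * ‖f x‖ ^ 2) (‖f‖ ^ 2) := by
  have h := Complex.hasSum_re (G.inner_hasSum f f)
  have h1 : (inner ℂ f f).re = ‖f‖ ^ 2 := inner_self_eq_norm_sq (𝕜 := ℂ) _
  rw [h1] at h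
  refine h.congr_fun fun x => ?_
  rw [Complex.re_ofReal_mul, mul_comm (starRingEnd ℂ (f x)), Complex.mul_conj,
    Complex.normSq_eq_norm_sq, Complex.ofReal_re]

theorem sum_m_mul_norm_sq_le (f : G.L2) (S : Finset X) :
    ∑ x ∈ S, G.m x * ‖f x‖ ^ 2 ≤ ‖f‖ ^ 2 :=
  sum_le_hasSum S (fun x _ => mul_nonneg (G.m_pos x).le (sq_nonneg _)) (G.hasSum_m_mul_norm_sq f)

theorem exists_finite_support_approx {u : G.L2} (hu : u ∈ G.formDomain) {δ : ℝ} (hδ : 0 < δ) :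
    ∃ φ : X → ℝ, (Function.support φ).Finite ∧
      (∀ S : Finset X, ∑ x ∈ S, G.m x * ((u x).re - φ x) ^ 2 ≤ δ) ∧
      (∀ S : Finset X, (1 / 2) * ∑ x ∈ S, ∑ y ∈ S,
        G.b x y * (((u x).re - φ x) - ((u y).re - φ y)) ^ 2 ≤ δ) := by
  obtain ⟨φ, hφ, h⟩ := hu (ENNReal.ofReal δ) (ENNReal.ofReal_pos.2 hδ)
  have hc : ∀ x, (u x).re - (φ x).re = ((u - φ : G.L2) x).re := fun x => by
    rw [coe_sub, Pi.sub_apply, Complex.sub_re]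
  refine ⟨fun x => (φ x).re, Set.Finite.subset hφ fun x hx => ?_, fun S => ?_, fun S => ?_⟩
  · rw [Function.mem_support] at hx ⊢
    intro h0
    exact hx (by rw [h0, Complex.zero_re])
  · have h1 : ‖u - φ‖ ^ 2 ≤ δ := by
      have := le_self_add.trans h.le
      rwa [← ofReal_norm, ← ENNReal.ofReal_pow (norm_nonneg _),
        ENNReal.ofReal_le_ofReal_iff hδ.le] at this
    refine le_trans (Finset.sum_le_sum fun x _ => ?_) ((G.sum_m_mul_norm_sq_le (u - φ) S).trans h1)
    rw [hc, ← sq_abs]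
    have := (G.m_pos x).le
    gcongr
    exact Complex.abs_re_le_norm _
  · refine le_trans ?_ (G.sum_b_mul_norm_sq_le hδ.le (le_add_self.trans h.le) S)
    refine mul_le_mul_of_nonneg_left (Finset.sum_le_sum fun x _ => Finset.sum_le_sum fun y _ =>
      mul_le_mul_of_nonneg_left ?_ (G.b_nonneg x y)) (by norm_num)
    rw [hc, hc, ← Complex.sub_re, ← sq_abs]
    exact pow_le_pow_left₀ (abs_nonneg _) (Complex.abs_re_le_norm _) 2

/-- **Maximum principle**: an element of the form domain lies below every non-negative
supersolution. No growth condition on `w` is needed, as `(φ - w)₊` is finitely supported along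
with `φ`. -/
theorem le_of_supersolution {ε : ℝ} (hε : 0 < ε) {u : G.L2} (hu : u ∈ G.formDomain) {w : X → ℝ}
    (hw : ∀ x, 0 ≤ w x)
    (h : ∀ x, (u x).re + ε * G.lap (fun y => (u y).re) x ≤ w x + ε * G.lap w x) (x : X) :
    (u x).re ≤ w x := by
  by_contra hlt
  have hd : 0 < (u x).re - w x := by linarith
  have hm := G.m_pos x
  obtain ⟨φ, hφ, h1, h2⟩ := G.exists_finite_support_approx hu
    (δ := G.m x * ((u x).re - w x) ^ 2 / (4 * (2 + ε))) (by positivity)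
  have h3 := G.m_mul_sq_le_of_approx hε hw h hφ h1 h2 x
  have h4 := h1 {x}
  rw [Finset.sum_singleton] at h4
  have h5 : φ x - w x ≤ max (φ x - w x) 0 := le_max_left _ _
  have h6 : ((u x).re - w x) ^ 2 ≤ (((u x).re - φ x) + max (φ x - w x) 0) ^ 2 := by
    apply pow_le_pow_left₀ hd.le
    linarith
  have h7 : G.m x * ((u x).re - w x) ^ 2 ≤
      2 * (G.m x * ((u x).re - φ x) ^ 2) + 2 * (G.m x * (max (φ x - w x) 0) ^ 2) := by
    nlinarith [mul_nonneg hm.le (sq_nonneg (((u x).re - φ x) - max (φ x - w x) 0)),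
      mul_le_mul_of_nonneg_left h6 hm.le]
  have h8 : (4 * (2 + ε)) * (G.m x * ((u x).re - w x) ^ 2 / (4 * (2 + ε))) =
      G.m x * ((u x).re - w x) ^ 2 := by field_simp
  have h9 : 0 < G.m x * ((u x).re - w x) ^ 2 := by positivity
  linarith

/-- The maximum principle for a `w` that is a supersolution only off the set `u ≤ w`; indeed
`min u w` is then a supersolution everywhere. -/
theorem le_of_supersolution_off {ε : ℝ} (hε : 0 < ε) {u : G.L2} (hu : u ∈ G.formDomain)
    (hu0 : ∀ x, 0 ≤ (u x).re) {w : X → ℝ} (hw : ∀ x, 0 ≤ w x)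
    (h : ∀ x, (u x).re ≤ w x ∨
      (u x).re + ε * G.lap (fun y => (u y).re) x ≤ w x + ε * G.lap w x) (x : X) :
    (u x).re ≤ w x := by
  refine (G.le_of_supersolution hε hu (w := fun y => min (u y).re (w y))
    (fun y => le_min (hu0 y) (hw y)) (fun y => ?_) x).trans (min_le_right _ _)
  by_cases hy : (u y).re ≤ w y
  · have h1 := G.lap_le_lap (f := fun y => (u y).re) (g := fun y => min (u y).re (w y)) (x := y)
      (min_eq_left hy).symm fun z => min_le_left _ _
    have := mul_le_mul_of_nonneg_left h1 hε.le
    rw [min_eq_left hy]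
    linarith
  · have h1 := G.lap_le_lap (f := w) (g := fun y => min (u y).re (w y)) (x := y)
      (min_eq_right (not_le.1 hy).le).symm fun z => min_le_right _ _
    have := mul_le_mul_of_nonneg_left h1 hε.le
    rw [min_eq_right (not_le.1 hy).le]
    linarith [(h y).resolve_left hy]

theorem eulerStep_re_eq {ε : ℝ} (hε : 0 < ε) (f : G.L2) (x : X) :
    (G.eulerStep ε f x).re + ε * G.lap (fun y => (G.eulerStep ε f y).re) x = (f x).re := by
  rw [← re_formalLaplacian, ← G.eulerStep_eq hε f x, Complex.add_re, Complex.re_ofReal_mul]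

theorem eulerStep_nonneg {ε : ℝ} (hε : 0 < ε) {f : G.L2} (hf : ∀ x, 0 ≤ (f x).re) (x : X) :
    0 ≤ (G.eulerStep ε f x).re := by
  have hneg : ∀ y, ((-G.eulerStep ε f : G.L2) y).re = 0 - (G.eulerStep ε f y).re := fun y => by
    rw [G.eq_of_ae (Lp.coeFn_neg _), Pi.neg_apply, Complex.neg_re, zero_sub]
  have h := G.le_of_supersolution hε (neg_mem (G.eulerStep_mem_formDomain hε f))
    (w := fun _ => 0) (fun _ => le_rfl) (fun y => ?_) x
  · rw [hneg] at h
    linarith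
  · simp only [hneg]
    rw [lap_const_sub, lap_const]
    linarith [hf y, G.eulerStep_re_eq hε f y]

end WeightedGraph

/-! ### Spheres and degrees -/

namespace WeightedGraph

variable {X : Type*} (G : WeightedGraph X)

theorem dist_cases {x y : X} (x₀ : X) (hy : y ∈ G.nbhd x) :
    G.graph.dist x₀ y = G.graph.dist x₀ x ∨ G.graph.dist x₀ y = G.graph.dist x₀ x + 1 ∨
      G.graph.dist x₀ y + 1 = G.graph.dist x₀ x := by
  have h : G.graph.Adj x y := G.mem_nbhd.1 hy
  rcases h.diff_dist_adj (u := x₀) with h | h | h <;> omega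

variable {G}

theorem exists_mem_nbhd_dist (hconn : G.graph.Connected) {x₀ x : X} {r : ℕ}
    (h : G.graph.dist x₀ x = r + 1) : ∃ y ∈ G.nbhd x, G.graph.dist x₀ y = r := by
  obtain ⟨p, hp⟩ := hconn.exists_walk_length_eq_dist x x₀
  rw [SimpleGraph.dist_comm, h] at hp
  cases p with
  | nil => simp at hp
  | cons hadj q =>
    rename_i y
    have hy : y ∈ G.nbhd x := G.mem_nbhd.2 hadj
    refine ⟨y, hy, ?_⟩
    have h1 : G.graph.dist x₀ y ≤ r := by
      rw [SimpleGraph.dist_comm]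
      refine (SimpleGraph.dist_le q).trans ?_
      rw [SimpleGraph.Walk.length_cons] at hp
      omega
    rcases G.dist_cases x₀ hy with h2 | h2 | h2 <;> omega

theorem finite_ball (hconn : G.graph.Connected) (x₀ : X) (r : ℕ) :
    {x | G.graph.dist x₀ x ≤ r}.Finite := by
  induction r with
  | zero =>
    refine (Set.finite_singleton x₀).subset fun x hx => ?_
    rw [Set.mem_ofPred_eq, Nat.le_zero, hconn.dist_eq_zero_iff] at hx
    exact hx.symm
  | succ r ih =>
    refine (ih.union (ih.biUnion fun z _ => (G.nbhd z).finite_toSet)).subset fun x hx => ?_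
    rcases (show G.graph.dist x₀ x ≤ r + 1 from hx).lt_or_eq with h | h
    · exact Or.inl (Nat.lt_succ_iff.1 h)
    · obtain ⟨y, hy, hyr⟩ := exists_mem_nbhd_dist hconn h
      refine Or.inr (Set.mem_biUnion (x := y) hyr.le ?_)
      rw [Finset.mem_coe, mem_nbhd, G.b_symm]
      exact G.mem_nbhd.1 hy

theorem finite_sphere (hconn : G.graph.Connected) (x₀ : X) (r : ℕ) : (G.sphere x₀ r).Finite :=
  (finite_ball hconn x₀ r).subset fun _ hx => le_of_eq hx

theorem tendsto_dist_cofinite (hconn : G.graph.Connected) (x₀ : X) :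
    Tendsto (fun x => G.graph.dist x₀ x) cofinite atTop := by
  rw [tendsto_atTop]
  intro r
  rw [eventually_cofinite]
  exact (finite_ball hconn x₀ r).subset fun x hx => (not_le.1 hx).le

theorem sphere_nonempty [Infinite X] (hconn : G.graph.Connected) (x₀ : X) (r : ℕ) :
    (G.sphere x₀ r).Nonempty := by
  have key : ∀ n : ℕ, ∀ x, G.graph.dist x₀ x = r + n → (G.sphere x₀ r).Nonempty := by
    intro n
    induction n with
    | zero => exact fun x hx => ⟨x, hx⟩
    | succ n ih =>
      intro x hx
      obtain ⟨y, _, hy⟩ := exists_mem_nbhd_dist hconn (r := r + n) hx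
      exact ih y hy
  obtain ⟨x, hx⟩ := ((tendsto_dist_cofinite hconn x₀).eventually_ge_atTop r).exists
  exact key (G.graph.dist x₀ x - r) x (by omega)

variable (G)

theorem b_pos_of_mem {x y : X} (hy : y ∈ G.nbhd x) : 0 < G.b x y := G.mem_nbhd.1 hy

open scoped Classical in
theorem m_mul_innerDeg (x₀ x : X) : G.m x * G.innerDeg x₀ x =
    ∑ y ∈ (G.nbhd x).filter (fun y => G.graph.dist x₀ y + 1 = G.graph.dist x₀ x), G.b x y := by
  rw [innerDeg, ← mul_assoc, mul_one_div_cancel (G.m_pos x).ne', one_mul]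

theorem m_mul_deg (x : X) : G.m x * G.deg x = ∑ y ∈ G.nbhd x, G.b x y := by
  rw [deg, ← mul_assoc, mul_one_div_cancel (G.m_pos x).ne', one_mul]

theorem innerDeg_le_deg (x₀ x : X) : G.innerDeg x₀ x ≤ G.deg x := by
  classical
  have h := G.m_pos x
  rw [← mul_le_mul_iff_of_pos_left h, m_mul_innerDeg, m_mul_deg]
  exact Finset.sum_le_sum_of_subset_of_nonneg (Finset.filter_subset _ _)
    fun y _ _ => G.b_nonneg x y

theorem deg_nonneg (x : X) : 0 ≤ G.deg x :=
  mul_nonneg (one_div_nonneg.2 (G.m_pos x).le) (Finset.sum_nonneg fun y _ => G.b_nonneg x y)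

variable {G}

theorem innerDeg_pos (hconn : G.graph.Connected) {x₀ x : X} {r : ℕ}
    (h : x ∈ G.sphere x₀ (r + 1)) : 0 < G.innerDeg x₀ x := by
  classical
  obtain ⟨y, hy, hyr⟩ := exists_mem_nbhd_dist hconn (show G.graph.dist x₀ x = r + 1 from h)
  refine mul_pos (one_div_pos.2 (G.m_pos x)) (Finset.sum_pos (fun z hz => ?_) ⟨y, ?_⟩)
  · exact G.b_pos_of_mem (Finset.mem_filter.1 hz).1
  · rw [Finset.mem_filter]
    exact ⟨hy, by rw [hyr]; exact (show G.graph.dist x₀ x = r + 1 from h).symm⟩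

theorem innerDeg_le_maxInnerDeg (hconn : G.graph.Connected) {x₀ x : X} {r : ℕ}
    (h : x ∈ G.sphere x₀ r) : G.innerDeg x₀ x ≤ G.maxInnerDeg x₀ r :=
  le_csSup ((finite_sphere hconn x₀ r).image _).bddAbove (Set.mem_image_of_mem _ h)

theorem deg_le_maxDeg (hconn : G.graph.Connected) {x₀ x : X} {r : ℕ}
    (h : x ∈ G.sphere x₀ r) : G.deg x ≤ G.maxDeg x₀ r :=
  le_csSup ((finite_sphere hconn x₀ r).image _).bddAbove (Set.mem_image_of_mem _ h)

theorem minInnerDeg_le_innerDeg (hconn : G.graph.Connected) {x₀ x : X} {r : ℕ}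
    (h : x ∈ G.sphere x₀ r) : G.minInnerDeg x₀ r ≤ G.innerDeg x₀ x :=
  csInf_le ((finite_sphere hconn x₀ r).image _).bddBelow (Set.mem_image_of_mem _ h)

theorem maxInnerDeg_pos [Infinite X] (hconn : G.graph.Connected) (x₀ : X) (r : ℕ) :
    0 < G.maxInnerDeg x₀ (r + 1) := by
  obtain ⟨x, hx⟩ := sphere_nonempty hconn x₀ (r + 1)
  exact (innerDeg_pos hconn hx).trans_le (innerDeg_le_maxInnerDeg hconn hx)

theorem minInnerDeg_pos [Infinite X] (hconn : G.graph.Connected) (x₀ : X) (r : ℕ) :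
    0 < G.minInnerDeg x₀ (r + 1) := by
  have h := ((sphere_nonempty hconn x₀ (r + 1)).image (G.innerDeg x₀)).csInf_mem
    ((finite_sphere hconn x₀ (r + 1)).image _)
  obtain ⟨x, hx, hx2⟩ := h
  have h2 : G.minInnerDeg x₀ (r + 1) = G.innerDeg x₀ x := hx2.symm
  rw [h2]
  exact innerDeg_pos hconn hx

theorem minInnerDeg_le_maxDeg [Infinite X] (hconn : G.graph.Connected) (x₀ : X) (r : ℕ) :
    G.minInnerDeg x₀ r ≤ G.maxDeg x₀ r := by
  obtain ⟨x, hx⟩ := sphere_nonempty hconn x₀ r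
  exact ((minInnerDeg_le_innerDeg hconn hx).trans (G.innerDeg_le_deg x₀ x)).trans
    (deg_le_maxDeg hconn hx)

variable (G)

/-- For a radially decreasing function, only the edges to the previous sphere contribute negatively
to the Laplacian. On the sphere of radius `0`, where `r - 1` is truncated, the bound is `0`. -/
theorem neg_innerDeg_mul_le_lap {H : ℕ → ℝ} (hH : Antitone H) (x₀ x : X) :
    -(G.innerDeg x₀ x * (H (G.graph.dist x₀ x - 1) - H (G.graph.dist x₀ x))) ≤
      G.lap (fun y => H (G.graph.dist x₀ y)) x := by
  classical
  rw [← mul_le_mul_iff_of_pos_left (G.m_pos x), G.m_mul_lap _ x subset_rfl, mul_neg, ← mul_assoc,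
    m_mul_innerDeg, Finset.sum_mul, ← Finset.sum_neg_distrib, Finset.sum_filter]
  refine Finset.sum_le_sum fun y hy => ?_
  split_ifs with h
  · rw [← h, Nat.add_sub_cancel]
    linarith
  · refine mul_nonneg (G.b_nonneg x y) (sub_nonneg.2 (hH ?_))
    rcases G.dist_cases x₀ hy with h2 | h2 | h2 <;> omega

/-- For a radially increasing function, the edges to the next sphere, of total weight at most
`m (Deg - Deg₋)`, are the only ones to contribute negatively to the Laplacian. -/
theorem le_lap_of_monotone {H : ℕ → ℝ} (hH : Monotone H) (x₀ x : X) :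
    G.innerDeg x₀ x * (H (G.graph.dist x₀ x) - H (G.graph.dist x₀ x - 1)) -
      (G.deg x - G.innerDeg x₀ x) * (H (G.graph.dist x₀ x + 1) - H (G.graph.dist x₀ x)) ≤
      G.lap (fun y => H (G.graph.dist x₀ y)) x := by
  classical
  rw [← mul_le_mul_iff_of_pos_left (G.m_pos x), G.m_mul_lap _ x subset_rfl, mul_sub, ← mul_assoc,
    ← mul_assoc, mul_sub (G.m x) (G.deg x), m_mul_deg, m_mul_innerDeg, sub_mul]
  simp only [Finset.sum_filter, Finset.sum_mul, ite_mul, zero_mul, ← Finset.sum_sub_distrib]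
  refine Finset.sum_le_sum fun y hy => ?_
  split_ifs with h
  · rw [← h, Nat.add_sub_cancel]
    linarith
  · have h1 : H (G.graph.dist x₀ y) ≤ H (G.graph.dist x₀ x + 1) := by
      apply hH
      rcases G.dist_cases x₀ hy with h2 | h2 | h2 <;> omega
    have := mul_le_mul_of_nonneg_left h1 (G.b_nonneg x y)
    linarith

end WeightedGraph

/-! ### The Feller property -/

/-- The partial products `∏_{s < r} (1 + a s)⁻¹` tend to zero if `∑ a s` diverges. -/
theorem tendsto_prod_inv_one_add_zero {a : ℕ → ℝ} (ha : ∀ s, 0 ≤ a s) (h : ¬ Summable a) :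
    Tendsto (fun r => ∏ s ∈ Finset.range r, (1 + a s)⁻¹) atTop (𝓝 0) := by
  have h1 : Tendsto (fun r => ∑ s ∈ Finset.range r, a s) atTop atTop :=
    (not_summable_iff_tendsto_nat_atTop_of_nonneg ha).1 h
  have h2 : ∀ r, ∑ s ∈ Finset.range r, a s ≤ ∏ s ∈ Finset.range r, (1 + a s) := by
    intro r
    suffices 1 + ∑ s ∈ Finset.range r, a s ≤ ∏ s ∈ Finset.range r, (1 + a s) by linarith
    induction r with
    | zero => simp
    | succ r ih =>
      rw [Finset.sum_range_succ, Finset.prod_range_succ]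
      have h3 : 0 ≤ ∑ s ∈ Finset.range r, a s := Finset.sum_nonneg fun s _ => ha s
      nlinarith [ha r, mul_nonneg h3 (ha r)]
  simp only [Finset.prod_inv_distrib]
  exact (tendsto_atTop_mono h2 h1).inv_tendsto_atTop

namespace WeightedGraph

section Superharmonic

variable {X : Type*} {G : WeightedGraph X}

/-- If `∑ 1/D₋(r) = ∞`, then there is a positive function `U` vanishing at infinity with
`ℒ U + U ≥ 0`. It is radial and solves `U(r) = D₋(r) (U(r - 1) - U(r))`. -/
theorem exists_superharmonic [Infinite X] (hconn : G.graph.Connected) {x₀ : X}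
    (h : ¬ Summable fun r : ℕ => 1 / G.maxInnerDeg x₀ (r + 1)) :
    ∃ U : X → ℝ, (∀ x, 0 < U x) ∧ Tendsto U cofinite (𝓝 0) ∧ ∀ x, -U x ≤ G.lap U x := by
  have hD := maxInnerDeg_pos hconn x₀
  have ha : ∀ s : ℕ, 0 ≤ 1 / G.maxInnerDeg x₀ (s + 1) := fun s => (one_div_pos.2 (hD s)).le
  set H : ℕ → ℝ := fun r => ∏ s ∈ Finset.range r, (1 + 1 / G.maxInnerDeg x₀ (s + 1))⁻¹ with hH
  have hpos : ∀ r, 0 < H r := fun r => Finset.prod_pos fun s _ => by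
    have := ha s
    positivity
  have hsucc : ∀ r, H r = H (r + 1) + H (r + 1) * (1 / G.maxInnerDeg x₀ (r + 1)) := by
    intro r
    have e : H (r + 1) = H r * (1 + 1 / G.maxInnerDeg x₀ (r + 1))⁻¹ :=
      Finset.prod_range_succ _ _
    have h1 : (1 + 1 / G.maxInnerDeg x₀ (r + 1)) ≠ 0 := by
      have := ha r
      positivity
    rw [← mul_one_add, e, mul_assoc, inv_mul_cancel₀ h1, mul_one]
  have hanti : Antitone H := antitone_nat_of_succ_le fun r => by
    rw [hsucc r]
    exact le_add_of_nonneg_right (mul_nonneg (hpos _).le (ha r))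
  refine ⟨fun x => H (G.graph.dist x₀ x), fun x => hpos _,
    (tendsto_prod_inv_one_add_zero ha h).comp (tendsto_dist_cofinite hconn x₀), fun x => ?_⟩
  refine le_trans ?_ (G.neg_innerDeg_mul_le_lap hanti x₀ x)
  rw [neg_le_neg_iff]
  change _ ≤ H (G.graph.dist x₀ x)
  rcases hr : G.graph.dist x₀ x with _ | r
  · simpa using (hpos 0).le
  · rw [Nat.add_sub_cancel, hsucc r, add_sub_cancel_left]
    have h1 := innerDeg_le_maxInnerDeg hconn (show x ∈ G.sphere x₀ (r + 1) from hr)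
    have h2 := mul_le_mul_of_nonneg_right h1 (mul_nonneg (hpos (r + 1)).le (ha r))
    refine h2.trans_eq ?_
    have := (hD r).ne'
    field_simp

end Superharmonic

variable {X : Type*} [MeasurableSpace X] [DiscreteMeasurableSpace X] {G : WeightedGraph X}

theorem delta_re_self (x : X) : (G.delta x x).re = 1 / G.m x := by
  rw [coe_delta, Set.indicator_of_mem (Set.mem_singleton x), ← Complex.ofReal_one,
    ← Complex.ofReal_div, Complex.ofReal_re]

theorem delta_re_of_ne {x y : X} (h : y ≠ x) : (G.delta x y).re = 0 := by
  rw [coe_delta, Set.indicator_of_notMem (by simpa using h), Complex.zero_re]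

theorem delta_re_nonneg (x y : X) : 0 ≤ (G.delta x y).re := by
  rcases eq_or_ne y x with rfl | h
  · rw [delta_re_self]
    exact (one_div_pos.2 (G.m_pos y)).le
  · rw [delta_re_of_ne h]

theorem eulerStep_pow_succ_apply (ε : ℝ) (k : ℕ) (f : G.L2) :
    (G.eulerStep ε ^ (k + 1)) f = G.eulerStep ε ((G.eulerStep ε ^ k) f) := by
  rw [pow_succ']
  rfl

theorem eulerStep_pow_nonneg {ε : ℝ} (hε : 0 < ε) {f : G.L2} (hf : ∀ x, 0 ≤ (f x).re) (k : ℕ)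
    (x : X) : 0 ≤ ((G.eulerStep ε ^ k) f x).re := by
  induction k generalizing x with
  | zero => exact hf x
  | succ k ih =>
    rw [eulerStep_pow_succ_apply]
    exact G.eulerStep_nonneg hε ih x

theorem tendsto_eulerStep_pow_heatKernel {t : ℝ} (ht : 0 < t) (x y : X) :
    Tendsto (fun j : ℕ => ((G.eulerStep (t / 2 ^ j) ^ 2 ^ j) (G.delta x) y).re) atTop
      (𝓝 (G.heatKernel t x y)) := by
  rw [heatKernel_symm]
  exact G.tendsto_eulerStep_pow_apply ht _ _

theorem heatKernel_nonneg {t : ℝ} (ht : 0 < t) (x y : X) : 0 ≤ G.heatKernel t x y :=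
  ge_of_tendsto' (tendsto_eulerStep_pow_heatKernel ht x y) fun j =>
    eulerStep_pow_nonneg (by positivity) (delta_re_nonneg x) _ y

/-- A positive `U` with `ℒ U + U ≥ 0` is, up to the factor `1 + 2ε ≥ (1 - ε)⁻¹`, a supersolution
for each step of the Euler scheme. -/
theorem eulerStep_pow_le {ε : ℝ} (hε : 0 < ε) (hε2 : ε ≤ 1 / 2) {U : X → ℝ} (hU : ∀ x, 0 < U x)
    (hL : ∀ x, -U x ≤ G.lap U x) {C : ℝ} (hC : 0 ≤ C) {f : G.L2}
    (hf : ∀ x, (f x).re ≤ C * U x) (k : ℕ) (x : X) :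
    ((G.eulerStep ε ^ k) f x).re ≤ C * (1 + 2 * ε) ^ k * U x := by
  induction k generalizing x with
  | zero => simpa using hf x
  | succ k ih =>
    rw [eulerStep_pow_succ_apply]
    refine G.le_of_supersolution hε (G.eulerStep_mem_formDomain hε _)
      (w := fun x => C * (1 + 2 * ε) ^ (k + 1) * U x)
      (fun y => mul_nonneg (by positivity) (hU y).le) (fun y => ?_) x
    rw [G.eulerStep_re_eq hε, lap_const_mul]
    refine (ih y).trans ?_
    have h1 : (1 - ε) * U y ≤ U y + ε * G.lap U y := by
      have := mul_le_mul_of_nonneg_left (hL y) hε.le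
      linarith
    have h2 : 1 ≤ (1 + 2 * ε) * (1 - ε) := by nlinarith
    have h3 : 0 ≤ C * (1 + 2 * ε) ^ k := by positivity
    calc C * (1 + 2 * ε) ^ k * U y ≤
        C * (1 + 2 * ε) ^ k * (((1 + 2 * ε) * (1 - ε)) * U y) := by
          refine mul_le_mul_of_nonneg_left ?_ h3
          exact le_mul_of_one_le_left (hU y).le h2
      _ = C * (1 + 2 * ε) ^ k * (1 + 2 * ε) * ((1 - ε) * U y) := by ring
      _ ≤ C * (1 + 2 * ε) ^ k * (1 + 2 * ε) * (U y + ε * G.lap U y) := by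
          exact mul_le_mul_of_nonneg_left h1 (by positivity)
      _ = _ := by ring

theorem isFeller_of_not_summable [Infinite X] (hconn : G.graph.Connected) {x₀ : X}
    (h : ¬ Summable fun r : ℕ => 1 / G.maxInnerDeg x₀ (r + 1)) : G.IsFeller := by
  obtain ⟨U, hU, hU0, hL⟩ := exists_superharmonic hconn h
  intro x t ht
  set C := (1 / G.m x) / U x
  have hC : 0 ≤ C := div_nonneg (one_div_pos.2 (G.m_pos x)).le (hU x).le
  have hf : ∀ y, (G.delta x y).re ≤ C * U y := by
    intro y
    rcases eq_or_ne y x with rfl | hy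
    · rw [delta_re_self, div_mul_cancel₀ _ (hU y).ne']
    · rw [delta_re_of_ne hy]
      exact mul_nonneg hC (hU y).le
  have hle : ∀ y, G.heatKernel t x y ≤ C * Real.exp (2 * t) * U y := by
    intro y
    refine le_of_tendsto (tendsto_eulerStep_pow_heatKernel ht x y) ?_
    have h2 : Tendsto (fun j : ℕ => t / (2 : ℝ) ^ j) atTop (𝓝 0) :=
      tendsto_const_nhds.div_atTop (tendsto_pow_atTop_atTop_of_one_lt one_lt_two)
    filter_upwards [h2.eventually_le_const (show (0 : ℝ) < 1 / 2 by norm_num)] with j hj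
    refine (eulerStep_pow_le (by positivity) hj hU hL hC hf _ y).trans ?_
    refine mul_le_mul_of_nonneg_right (mul_le_mul_of_nonneg_left ?_ hC) (hU y).le
    calc (1 + 2 * (t / 2 ^ j)) ^ 2 ^ j ≤ Real.exp (2 * (t / 2 ^ j)) ^ 2 ^ j := by
          refine pow_le_pow_left₀ (by positivity) ?_ _
          rw [add_comm]
          exact Real.add_one_le_exp _
      _ = Real.exp (2 * t) := by
          rw [← Real.exp_nat_mul]
          congr 1
          push_cast
          field_simp
  refine squeeze_zero (fun y => heatKernel_nonneg ht x y) hle ?_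
  simpa using hU0.const_mul (C * Real.exp (2 * t))

end WeightedGraph

/-! ### Finite measure and the constant function -/

namespace WeightedGraph

section Spheres

variable {X : Type*} {G : WeightedGraph X}

theorem sum_b_le (x : X) (T : Finset X) : ∑ y ∈ T, G.b x y ≤ G.m x * G.deg x := by
  classical
  rw [m_mul_deg]
  have h : ∑ y ∈ T, G.b x y = ∑ y ∈ T.filter (· ∈ G.nbhd x), G.b x y := by
    refine (Finset.sum_filter_of_ne fun y _ hy => ?_).symm
    exact G.mem_nbhd.2 (lt_of_le_of_ne (G.b_nonneg x y) (Ne.symm hy))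
  rw [h]
  exact Finset.sum_le_sum_of_subset_of_nonneg (fun y hy => (Finset.mem_filter.1 hy).2)
    fun y _ _ => G.b_nonneg x y

/-- The sphere as a finite set. -/
noncomputable def sphereFinset (hconn : G.graph.Connected) (x₀ : X) (r : ℕ) : Finset X :=
  (finite_sphere hconn x₀ r).toFinset

theorem mem_sphereFinset (hconn : G.graph.Connected) {x₀ x : X} {r : ℕ} :
    x ∈ sphereFinset hconn x₀ r ↔ G.graph.dist x₀ x = r := by
  rw [sphereFinset, Set.Finite.mem_toFinset]
  rfl

theorem sum_sphere_b (hconn : G.graph.Connected) {x₀ x : X} {r : ℕ}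
    (hx : G.graph.dist x₀ x = r + 1) :
    ∑ y ∈ sphereFinset hconn x₀ r, G.b x y = G.m x * G.innerDeg x₀ x := by
  classical
  rw [m_mul_innerDeg]
  symm
  refine Finset.sum_subset (fun y hy => ?_) fun y hy hy2 => ?_
  · rw [Finset.mem_filter] at hy
    rw [mem_sphereFinset]
    omega
  · rw [Finset.mem_filter, mem_nbhd, not_and_or] at hy2
    rw [mem_sphereFinset] at hy
    rcases hy2 with h | h
    · exact le_antisymm (not_lt.1 h) (G.b_nonneg x y)
    · omega

/-- The mass of a sphere. -/
noncomputable def sphereMass (hconn : G.graph.Connected) (x₀ : X) (r : ℕ) : ℝ :=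
  ∑ x ∈ sphereFinset hconn x₀ r, G.m x

/-- The total edge weight between the spheres of radius `r` and `r + 1`. -/
noncomputable def sphereBoundary (hconn : G.graph.Connected) (x₀ : X) (r : ℕ) : ℝ :=
  ∑ x ∈ sphereFinset hconn x₀ r, ∑ y ∈ sphereFinset hconn x₀ (r + 1), G.b x y

theorem sphereMass_nonneg (hconn : G.graph.Connected) (x₀ : X) (r : ℕ) :
    0 ≤ sphereMass hconn x₀ r :=
  Finset.sum_nonneg fun x _ => (G.m_pos x).le

theorem sphereBoundary_nonneg (hconn : G.graph.Connected) (x₀ : X) (r : ℕ) :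
    0 ≤ sphereBoundary hconn x₀ r :=
  Finset.sum_nonneg fun x _ => Finset.sum_nonneg fun y _ => G.b_nonneg x y

theorem minInnerDeg_mul_sphereMass_le (hconn : G.graph.Connected) (x₀ : X) (r : ℕ) :
    G.minInnerDeg x₀ (r + 1) * sphereMass hconn x₀ (r + 1) ≤ sphereBoundary hconn x₀ r := by
  rw [sphereBoundary, Finset.sum_comm, sphereMass, Finset.mul_sum]
  refine Finset.sum_le_sum fun x hx => ?_
  rw [mem_sphereFinset] at hx
  simp only [G.b_symm _ x]
  rw [sum_sphere_b hconn hx, mul_comm]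
  exact mul_le_mul_of_nonneg_left (minInnerDeg_le_innerDeg hconn hx) (G.m_pos x).le

theorem sphereBoundary_succ_le (hconn : G.graph.Connected) (x₀ : X) (r : ℕ) :
    sphereBoundary hconn x₀ (r + 1) ≤
      (G.maxDeg x₀ (r + 1) - G.minInnerDeg x₀ (r + 1)) * sphereMass hconn x₀ (r + 1) := by
  classical
  rw [sphereBoundary, sphereMass, Finset.mul_sum]
  refine Finset.sum_le_sum fun x hx => ?_
  rw [mem_sphereFinset] at hx
  have hd : Disjoint (sphereFinset hconn x₀ (r + 1 + 1)) (sphereFinset hconn x₀ r) := by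
    rw [Finset.disjoint_left]
    intro y h1 h2
    rw [mem_sphereFinset] at h1 h2
    omega
  have h1 := sum_b_le (G := G) x (sphereFinset hconn x₀ (r + 1 + 1) ∪ sphereFinset hconn x₀ r)
  rw [Finset.sum_union hd, sum_sphere_b hconn hx] at h1
  have h2 := mul_le_mul_of_nonneg_left (deg_le_maxDeg hconn hx) (G.m_pos x).le
  have h3 := mul_le_mul_of_nonneg_left (minInnerDeg_le_innerDeg hconn hx) (G.m_pos x).le
  linarith

theorem summable_sphereBoundary [Infinite X] (hconn : G.graph.Connected) {x₀ : X}
    (h : Summable fun r : ℕ =>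
      (G.maxDeg x₀ (r + 1) - G.minInnerDeg x₀ (r + 1) + 1) / G.minInnerDeg x₀ (r + 1)) :
    Summable (sphereBoundary hconn x₀) ∧ Summable (sphereMass hconn x₀) := by
  have hd := minInnerDeg_pos hconn x₀
  have hD : ∀ r, G.minInnerDeg x₀ (r + 1) ≤ G.maxDeg x₀ (r + 1) := fun r =>
    minInnerDeg_le_maxDeg hconn x₀ _
  have hev := h.tendsto_atTop_zero.eventually_le_const (show (0 : ℝ) < 1 / 2 by norm_num)
  have hE : Summable (sphereBoundary hconn x₀) := by
    refine summable_of_ratio_norm_eventually_le (r := 1 / 2) (by norm_num) ?_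
    filter_upwards [hev] with r hr
    rw [Real.norm_of_nonneg (sphereBoundary_nonneg hconn x₀ _),
      Real.norm_of_nonneg (sphereBoundary_nonneg hconn x₀ _)]
    rw [div_le_iff₀ (hd r)] at hr
    have h1 := minInnerDeg_mul_sphereMass_le hconn x₀ r
    have h2 : (G.maxDeg x₀ (r + 1) - G.minInnerDeg x₀ (r + 1)) * sphereMass hconn x₀ (r + 1) ≤
        1 / 2 * G.minInnerDeg x₀ (r + 1) * sphereMass hconn x₀ (r + 1) :=
      mul_le_mul_of_nonneg_right (by linarith) (sphereMass_nonneg hconn x₀ _)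
    linarith [sphereBoundary_succ_le hconn x₀ r]
  refine ⟨hE, (summable_nat_add_iff 1).1 ?_⟩
  refine hE.of_norm_bounded_eventually_nat ?_
  filter_upwards [hev] with r hr
  rw [Real.norm_of_nonneg (sphereMass_nonneg hconn x₀ _)]
  rw [div_le_iff₀ (hd r)] at hr
  have h1 := minInnerDeg_mul_sphereMass_le hconn x₀ r
  have h2 : 1 * sphereMass hconn x₀ (r + 1) ≤
      G.minInnerDeg x₀ (r + 1) * sphereMass hconn x₀ (r + 1) :=
    mul_le_mul_of_nonneg_right (by linarith [hD r]) (sphereMass_nonneg hconn x₀ _)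
  linarith

theorem summable_m (hconn : G.graph.Connected) {x₀ : X} (h : Summable (sphereMass hconn x₀)) :
    Summable G.m := by
  classical
  refine summable_of_sum_le (c := ∑' r, sphereMass hconn x₀ r) (fun x => (G.m_pos x).le)
    fun F => ?_
  rw [← Finset.sum_fiberwise_of_maps_to (s := F) (t := F.image fun x => G.graph.dist x₀ x)
    (g := fun x => G.graph.dist x₀ x) fun x hx => Finset.mem_image_of_mem _ hx]
  refine le_trans (Finset.sum_le_sum fun r _ => ?_)
    (h.sum_le_tsum _ fun r _ => sphereMass_nonneg hconn x₀ r)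
  refine Finset.sum_le_sum_of_subset_of_nonneg (fun x hx => ?_) fun x _ _ => (G.m_pos x).le
  rw [mem_sphereFinset]
  exact (Finset.mem_filter.1 hx).2

/-- The energy of the cutoff `1 - 1_{B_r}` is at most the edge weight across the boundary of the
ball `B_r`. -/
theorem energy_indicator_le (hconn : G.graph.Connected) (x₀ : X) (r : ℕ) :
    G.energy (fun x => if G.graph.dist x₀ x ≤ r then 0 else 1) ≤
      ENNReal.ofReal (sphereBoundary hconn x₀ r) := by
  classical
  set S := sphereFinset hconn x₀ r with hS
  set T := sphereFinset hconn x₀ (r + 1) with hT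
  set A : X → X → ℝ≥0∞ := fun x y => if x ∈ S then if y ∈ T then ENNReal.ofReal (G.b x y) else 0
    else 0 with hA
  have h1 : ∑' x, ∑' y, A x y = ENNReal.ofReal (sphereBoundary hconn x₀ r) := by
    rw [tsum_eq_sum (s := S) fun x hx => by simp [hA, hx], sphereBoundary,
      ENNReal.ofReal_sum_of_nonneg fun x _ => Finset.sum_nonneg fun y _ => G.b_nonneg x y]
    refine Finset.sum_congr rfl fun x hx => ?_
    rw [tsum_eq_sum (s := T) fun y hy => by simp [hA, hy],
      ENNReal.ofReal_sum_of_nonneg fun y _ => G.b_nonneg x y]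
    exact Finset.sum_congr rfl fun y hy =>
      (if_pos (show x ∈ S from hx)).trans (if_pos (show y ∈ T from hy))
  have h2 : ∑' x, ∑' y, A y x = ENNReal.ofReal (sphereBoundary hconn x₀ r) := by
    rw [ENNReal.tsum_comm, h1]
  have h3 : ∀ x y, ENNReal.ofReal (G.b x y) *
      ‖(if G.graph.dist x₀ x ≤ r then (0 : ℂ) else 1) -
        (if G.graph.dist x₀ y ≤ r then 0 else 1)‖ₑ ^ 2 ≤ A x y + A y x := by
    intro x y
    by_cases hb : 0 < G.b x y
    · have hc := G.dist_cases x₀ (G.mem_nbhd.2 hb)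
      by_cases hx : G.graph.dist x₀ x ≤ r <;> by_cases hy : G.graph.dist x₀ y ≤ r
      · simp [hx, hy]
      · have hx' : x ∈ S := (mem_sphereFinset hconn).2 (by omega)
        have hy' : y ∈ T := (mem_sphereFinset hconn).2 (by omega)
        simp [hx, hy, hA, hx', hy']
      · have hx' : x ∈ T := (mem_sphereFinset hconn).2 (by omega)
        have hy' : y ∈ S := (mem_sphereFinset hconn).2 (by omega)
        simp [hx, hy, hA, hx', hy', G.b_symm y x]
      · simp [hx, hy]
    · rw [le_antisymm (not_lt.1 hb) (G.b_nonneg x y)]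
      simp
  unfold energy
  calc _ ≤ (1 / 2) * ∑' x, ∑' y, (A x y + A y x) := by
        gcongr with x y
        exact h3 x y
    _ = (1 / 2) * (ENNReal.ofReal (sphereBoundary hconn x₀ r) +
          ENNReal.ofReal (sphereBoundary hconn x₀ r)) := by
        simp only [ENNReal.tsum_add, h1, h2]
    _ = ENNReal.ofReal (sphereBoundary hconn x₀ r) := by
        rw [← two_mul, ← mul_assoc, one_div, ENNReal.inv_mul_cancel (by simp) (by simp), one_mul]

end Spheres

variable {X : Type*} [MeasurableSpace X] [DiscreteMeasurableSpace X] {G : WeightedGraph X}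

/-- If the spheres have summable masses and the boundaries of the balls have arbitrarily small
weight, then the constant function `1` belongs to the form domain. -/
theorem exists_one_mem_formDomain (hconn : G.graph.Connected) {x₀ : X}
    (hM : Summable (sphereMass hconn x₀))
    (hE : Tendsto (sphereBoundary hconn x₀) atTop (𝓝 0)) :
    ∃ u ∈ G.formDomain, ∀ x, u x = 1 := by
  have hm := summable_m hconn hM
  have hfin : IsFiniteMeasure G.vertexMeasure := by
    refine ⟨?_⟩
    rw [vertexMeasure, Measure.sum_apply _ MeasurableSet.univ]
    simp only [Measure.smul_apply, measure_univ, smul_eq_mul, mul_one]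
    rw [← ENNReal.ofReal_tsum_of_nonneg (fun x => (G.m_pos x).le) hm]
    exact ENNReal.ofReal_lt_top
  have h1 : MemLp (fun _ : X => (1 : ℂ)) 2 G.vertexMeasure := memLp_const 1
  have hu : (h1.toLp : X → ℂ) = fun _ => 1 := G.eq_of_ae h1.coeFn_toLp
  refine ⟨h1.toLp, fun ε hε => ?_, fun x => congrFun hu x⟩
  have hs : ∀ r : ℕ, (Function.support fun x =>
      if G.graph.dist x₀ x ≤ r then (1 : ℂ) else 0).Finite := fun r =>
    (finite_ball hconn x₀ r).subset fun x hx => by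
      by_contra h0
      exact hx (if_neg h0)
  set φ : ℕ → G.L2 := fun r => (G.memLp_of_finite_support (hs r)).toLp with hφ
  have hφc : ∀ r, (φ r : X → ℂ) = fun x => if G.graph.dist x₀ x ≤ r then (1 : ℂ) else 0 :=
    fun r => G.eq_of_ae (MemLp.coeFn_toLp _)
  have hdiff : ∀ r, ((h1.toLp - φ r : G.L2) : X → ℂ) =
      fun x => if G.graph.dist x₀ x ≤ r then 0 else 1 := by
    intro r
    rw [coe_sub, hu, hφc]
    funext x
    simp only [Pi.sub_apply]
    split_ifs <;> simp
  have hn : Tendsto (fun r => ‖h1.toLp - φ r‖ ^ 2) atTop (𝓝 0) := by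
    have h2 : ∀ r, ‖h1.toLp - φ r‖ ^ 2 =
        ∑' x, G.m x * ‖(if G.graph.dist x₀ x ≤ r then (0 : ℂ) else 1)‖ ^ 2 := fun r => by
      rw [← (G.hasSum_m_mul_norm_sq (h1.toLp - φ r)).tsum_eq, hdiff]
    simp only [h2]
    rw [show (0 : ℝ) = ∑' _ : X, (0 : ℝ) from tsum_zero.symm]
    refine tendsto_tsum_of_dominated_convergence hm (fun x => ?_)
      (Eventually.of_forall fun r x => ?_)
    · refine tendsto_const_nhds.congr' ?_
      filter_upwards [eventually_ge_atTop (G.graph.dist x₀ x)] with r hr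
      simp [hr]
    · have := G.m_pos x
      split_ifs <;> simp [abs_of_pos this, this.le]
  have hlim : Tendsto (fun r => ENNReal.ofReal (‖h1.toLp - φ r‖ ^ 2) +
      ENNReal.ofReal (sphereBoundary hconn x₀ r)) atTop (𝓝 0) := by
    simpa using (ENNReal.tendsto_ofReal hn).add (ENNReal.tendsto_ofReal hE)
  obtain ⟨r, hr⟩ := (hlim.eventually_lt_const hε).exists
  refine ⟨φ r, ?_, lt_of_le_of_lt (add_le_add ?_ ?_) hr⟩
  · change (Function.support (φ r : X → ℂ)).Finite
    rw [hφc]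
    exact hs r
  · rw [ENNReal.ofReal_pow (norm_nonneg _), ofReal_norm]
  · rw [hdiff]
    exact energy_indicator_le hconn x₀ r

end WeightedGraph

/-! ### Lower bounds for the heat kernel -/

namespace WeightedGraph

section Radial

variable {X : Type*} {G : WeightedGraph X}

/-- Let `a r` denote the summand of radius `r + 1` in the hypothesis. A multiple `h` of
`∑ a r`, the sum over the radii between `N` and that of the vertex, satisfies `ℒ h ≥ κ` off the
ball `B_N`, and `h ≤ 1/2` if `N` is large. In terms of the random walk, `h / κ` bounds the mean time
the walk takes from a vertex to `B_N`. -/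
theorem exists_radial_lap_ge [Infinite X] (hconn : G.graph.Connected) {x₀ : X}
    (h : Summable fun r : ℕ =>
      (G.maxDeg x₀ (r + 1) - G.minInnerDeg x₀ (r + 1) + 1) / G.minInnerDeg x₀ (r + 1))
    {κ : ℝ} (hκ : 0 < κ) :
    ∃ (N : ℕ) (u : X → ℝ), (∀ x, 0 ≤ u x) ∧ (∀ x, u x ≤ 1 / 2) ∧
      ∀ x, N < G.graph.dist x₀ x → κ ≤ G.lap u x := by
  set a : ℕ → ℝ := fun r =>
    (G.maxDeg x₀ (r + 1) - G.minInnerDeg x₀ (r + 1) + 1) / G.minInnerDeg x₀ (r + 1) with ha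
  have hd := minInnerDeg_pos hconn x₀
  have hD : ∀ r, G.minInnerDeg x₀ (r + 1) ≤ G.maxDeg x₀ (r + 1) := fun r =>
    minInnerDeg_le_maxDeg hconn x₀ _
  have ha0 : ∀ r, 0 ≤ a r := fun r => div_nonneg (by linarith [hD r]) (hd r).le
  obtain ⟨N₁, hN₁⟩ := eventually_atTop.1
    (h.tendsto_atTop_zero.eventually_le_const (show (0 : ℝ) < 1 by norm_num))
  obtain ⟨N, hN, hN₁'⟩ := (((tendsto_sum_nat_add a).eventually_le_const
    (show (0 : ℝ) < 1 / 2 / κ by positivity)).and (eventually_ge_atTop N₁)).exists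
  set H : ℕ → ℝ := fun r => κ * ∑ i ∈ Finset.Ico N r, a i with hH
  have hmono : Monotone H := fun r s hrs => by
    refine mul_le_mul_of_nonneg_left ?_ hκ.le
    exact Finset.sum_le_sum_of_subset_of_nonneg (Finset.Ico_subset_Ico_right hrs)
      fun i _ _ => ha0 i
  have hsucc : ∀ r, N ≤ r → H (r + 1) - H r = κ * a r := fun r hr => by
    simp only [hH]
    rw [Finset.sum_Ico_succ_top hr]
    ring
  refine ⟨N, fun x => H (G.graph.dist x₀ x), fun x => ?_, fun x => ?_, fun x hx => ?_⟩
  · exact mul_nonneg hκ.le (Finset.sum_nonneg fun i _ => ha0 i)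
  · have h1 : ∑ i ∈ Finset.Ico N (G.graph.dist x₀ x), a i ≤ 1 / 2 / κ := by
      rw [Finset.sum_Ico_eq_sum_range]
      simp only [add_comm N]
      exact (((summable_nat_add_iff N).2 h).sum_le_tsum _ fun i _ => ha0 (i + N)).trans hN
    rw [le_div_iff₀ hκ] at h1
    simp only [hH]
    linarith
  · refine le_trans ?_ (G.le_lap_of_monotone hmono x₀ x)
    obtain ⟨r, hr⟩ : ∃ r, G.graph.dist x₀ x = r + 1 := ⟨G.graph.dist x₀ x - 1, by omega⟩
    have hNr : N ≤ r := by omega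
    rw [hr, Nat.add_sub_cancel, hsucc r hNr, hsucc (r + 1) (by omega)]
    have h1 := minInnerDeg_le_innerDeg hconn (show x ∈ G.sphere x₀ (r + 1) from hr)
    have h2 := deg_le_maxDeg hconn (show x ∈ G.sphere x₀ (r + 1) from hr)
    have h3 := G.innerDeg_le_deg x₀ x
    have h4 : a (r + 1) ≤ 1 := hN₁ (r + 1) (by omega)
    have h5 : G.minInnerDeg x₀ (r + 1) * a r =
        G.maxDeg x₀ (r + 1) - G.minInnerDeg x₀ (r + 1) + 1 := mul_div_cancel₀ _ (hd r).ne'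
    have h6 := mul_le_mul_of_nonneg_right h1 (ha0 r)
    have h7 := mul_le_mul_of_nonneg_left h4 (sub_nonneg.2 h3)
    have h8 : 1 ≤ G.innerDeg x₀ x * a r - (G.deg x - G.innerDeg x₀ x) * a (r + 1) := by linarith
    have h9 := mul_le_mul_of_nonneg_left h8 hκ.le
    linarith

theorem lap_le_of_nonneg {f : X → ℝ} (hf : ∀ x, 0 ≤ f x) {x y : X} (hy : y ∈ G.nbhd x) :
    G.lap f x ≤ G.deg x * f x - G.b x y / G.m x * f y := by
  have hm := G.m_pos x
  rw [← mul_le_mul_iff_of_pos_left hm, G.m_mul_lap f x subset_rfl, mul_sub, ← mul_assoc,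
    m_mul_deg, Finset.sum_mul]
  simp only [mul_sub, Finset.sum_sub_distrib]
  have h1 : G.b x y * f y ≤ ∑ z ∈ G.nbhd x, G.b x z * f z :=
    Finset.single_le_sum (f := fun z => G.b x z * f z)
      (fun z _ => mul_nonneg (G.b_nonneg x z) (hf z)) hy
  have h2 : G.m x * (G.b x y / G.m x * f y) = G.b x y * f y := by field_simp
  linarith

theorem lap_le_deg_mul {f : X → ℝ} (hf : ∀ x, 0 ≤ f x) (x : X) : G.lap f x ≤ G.deg x * f x := by
  have hm := G.m_pos x
  rw [← mul_le_mul_iff_of_pos_left hm, G.m_mul_lap f x subset_rfl, ← mul_assoc,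
    m_mul_deg, Finset.sum_mul]
  exact Finset.sum_le_sum fun y _ =>
    mul_le_mul_of_nonneg_left (by linarith [hf y]) (G.b_nonneg x y)

end Radial

variable {X : Type*} [MeasurableSpace X] [DiscreteMeasurableSpace X] {G : WeightedGraph X}

theorem one_add_mul_pow_le_exp {ε t D : ℝ} (hε : 0 < ε) (hD : 0 ≤ D) {k : ℕ} (hk : k * ε ≤ t) :
    (1 + ε * D) ^ k ≤ Real.exp (t * D) := by
  calc (1 + ε * D) ^ k ≤ Real.exp (ε * D) ^ k := by
        refine pow_le_pow_left₀ (by positivity) ?_ _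
        rw [add_comm]
        exact Real.add_one_le_exp _
    _ = Real.exp (k * ε * D) := by rw [← Real.exp_nat_mul, mul_assoc]
    _ ≤ Real.exp (t * D) := Real.exp_le_exp.2 (mul_le_mul_of_nonneg_right hk hD)

theorem eulerStep_pow_le_const {ε : ℝ} (hε : 0 < ε) {C : ℝ} (hC : 0 ≤ C) {f : G.L2}
    (hf : ∀ x, (f x).re ≤ C) (k : ℕ) (x : X) : ((G.eulerStep ε ^ k) f x).re ≤ C := by
  induction k generalizing x with
  | zero => exact hf x
  | succ k ih =>
    rw [eulerStep_pow_succ_apply]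
    refine G.le_of_supersolution hε (G.eulerStep_mem_formDomain hε _) (w := fun _ => C)
      (fun _ => hC) (fun y => ?_) x
    rw [G.eulerStep_re_eq hε, lap_const]
    linarith [ih y]

/-- Positivity spreads: for every vertex `z` the Euler iterates of `δ_x` are bounded below at `z`,
uniformly in the step size, once the elapsed time is at least `s`. This goes by induction along a
path from `x` to `z`, the time `s` being halved with each edge. -/
theorem exists_eulerStep_pow_ge (hconn : G.graph.Connected) (x : X) (t : ℝ) (z : X) :
    ∀ s : ℝ, 0 < s → ∃ c : ℝ, 0 < c ∧ ∀ ε : ℝ, 0 < ε → ∀ k : ℕ, k * ε ≤ t → s ≤ k * ε →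
      c ≤ ((G.eulerStep ε ^ k) (G.delta x) z).re := by
  have hreach := (SimpleGraph.reachable_iff_reflTransGen x z).1 (hconn.preconnected x z)
  induction hreach with
  | refl =>
    intro s _
    refine ⟨Real.exp (-(t * G.deg x)) * (1 / G.m x),
      mul_pos (Real.exp_pos _) (one_div_pos.2 (G.m_pos x)), fun ε hε k hk _ => ?_⟩
    have hD := G.deg_nonneg x
    have hnn := eulerStep_pow_nonneg (G := G) hε (delta_re_nonneg x)
    have key : ∀ k : ℕ,
        1 / G.m x ≤ (1 + ε * G.deg x) ^ k * ((G.eulerStep ε ^ k) (G.delta x) x).re := by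
      intro k
      induction k with
      | zero => simp [delta_re_self]
      | succ k ih =>
        refine ih.trans ?_
        rw [pow_succ, mul_assoc]
        refine mul_le_mul_of_nonneg_left ?_ (by positivity)
        rw [eulerStep_pow_succ_apply, ← G.eulerStep_re_eq hε ((G.eulerStep ε ^ k) (G.delta x)) x]
        have h1 := lap_le_deg_mul (G := G)
          (f := fun y => (G.eulerStep ε ((G.eulerStep ε ^ k) (G.delta x)) y).re)
          (fun y => G.eulerStep_nonneg hε (hnn k) y) x
        have := mul_le_mul_of_nonneg_left h1 hε.le
        linarith
    have h2 := (key k).trans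
      (mul_le_mul_of_nonneg_right (one_add_mul_pow_le_exp hε hD hk) (hnn k x))
    rw [Real.exp_neg, inv_mul_le_iff₀ (Real.exp_pos _)]
    exact h2
  | @tail y z _ hyz ih =>
    intro s hs
    obtain ⟨c, hc, hcy⟩ := ih (s / 2) (half_pos hs)
    have hy : y ∈ G.nbhd z := G.mem_nbhd.2 (by rw [G.b_symm]; exact hyz)
    have hβ : 0 < G.b z y / G.m z := div_pos (G.mem_nbhd.1 hy) (G.m_pos z)
    set β := G.b z y / G.m z with hβdef
    refine ⟨Real.exp (-(t * G.deg z)) * (s / 2 * (β * c)), by positivity,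
      fun ε hε k hk hks => ?_⟩
    have hD := G.deg_nonneg z
    have hnn := eulerStep_pow_nonneg (G := G) hε (delta_re_nonneg x)
    -- each step after the time `s / 2` feeds at least `ε β c` from `y` into `z`, up to the decay
    -- factor `1 + ε Deg(z)`
    have key : ∀ k : ℕ, k * ε ≤ t → (k * ε - s / 2) * (β * c) ≤
        (1 + ε * G.deg z) ^ k * ((G.eulerStep ε ^ k) (G.delta x) z).re := by
      intro k
      induction k with
      | zero =>
        intro _
        refine le_trans ?_ (mul_nonneg (by positivity) (hnn 0 z))
        refine mul_nonpos_of_nonpos_of_nonneg ?_ (by positivity)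
        simpa using (half_pos hs).le
      | succ k ih =>
        intro hk
        have hk' : ((k : ℝ) + 1) * ε ≤ t := by exact_mod_cast hk
        rcases le_total (((k : ℝ) + 1) * ε) (s / 2) with h | h
        · refine le_trans ?_ (mul_nonneg (by positivity) (hnn (k + 1) z))
          refine mul_nonpos_of_nonpos_of_nonneg ?_ (by positivity)
          push_cast
          linarith
        · have h1 := ih (by linarith)
          have h2 := hcy ε hε (k + 1) hk (by exact_mod_cast h)
          have h3 := lap_le_of_nonneg (G := G)
            (f := fun y => ((G.eulerStep ε ^ (k + 1)) (G.delta x) y).re) (hnn (k + 1)) hy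
          have h4 : ((G.eulerStep ε ^ (k + 1)) (G.delta x) z).re +
              ε * G.lap (fun y => ((G.eulerStep ε ^ (k + 1)) (G.delta x) y).re) z =
              ((G.eulerStep ε ^ k) (G.delta x) z).re := by
            simp only [eulerStep_pow_succ_apply]
            exact G.eulerStep_re_eq hε _ z
          have h5 := mul_le_mul_of_nonneg_left h3 hε.le
          have h6 := mul_le_mul_of_nonneg_left h2 (mul_pos hε hβ).le
          have h7 : ((G.eulerStep ε ^ k) (G.delta x) z).re + ε * β * c ≤
              (1 + ε * G.deg z) * ((G.eulerStep ε ^ (k + 1)) (G.delta x) z).re := by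
            simp only [← hβdef] at h5
            linarith
          have h8 : 1 ≤ (1 + ε * G.deg z) ^ k :=
            one_le_pow₀ (le_add_of_nonneg_right (mul_nonneg hε.le hD))
          have h9 := mul_le_mul_of_nonneg_left h7 (zero_le_one.trans h8)
          have h10 : ε * β * c ≤ (1 + ε * G.deg z) ^ k * (ε * β * c) :=
            le_mul_of_one_le_left (by positivity) h8
          rw [pow_succ, mul_assoc, Nat.cast_succ]
          linarith
    have h1 : s / 2 * (β * c) ≤ (k * ε - s / 2) * (β * c) :=
      mul_le_mul_of_nonneg_right (by linarith) (by positivity)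
    have h2 := (h1.trans (key k hk)).trans
      (mul_le_mul_of_nonneg_right (one_add_mul_pow_le_exp hε hD hk) (hnn k z))
    rw [Real.exp_neg, inv_mul_le_iff₀ (Real.exp_pos _)]
    exact h2

/-- Comparison of the Euler iterates `u_k` of `f` with `c (κ (kε - t/2) - h)`, where `κ = 2/t`,
`ℒ h ≥ κ` off a set `B`, and `u_k ≥ c` on `B` after the time `t/2`. As the constants belong to the
form domain, the maximum principle applies to `K - u_k` with a large constant `K`. -/
theorem eulerStep_pow_ge_of_lap_ge {one : G.L2} (hone : one ∈ G.formDomain)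
    (hone1 : ∀ x, one x = 1) {f : G.L2} (hf : ∀ x, 0 ≤ (f x).re) {C : ℝ} (hC : 0 ≤ C)
    (hfC : ∀ x, (f x).re ≤ C) {t c : ℝ} (ht : 0 < t) (hc : 0 < c) {h : X → ℝ} (h0 : ∀ x, 0 ≤ h x)
    {B : Set X} (hB : ∀ x ∉ B, 2 / t ≤ G.lap h x) {ε : ℝ} (hε : 0 < ε)
    (hu : ∀ x ∈ B, ∀ k : ℕ, k * ε ≤ t → t / 2 ≤ k * ε → c ≤ ((G.eulerStep ε ^ k) f x).re)
    (k : ℕ) (hk : k * ε ≤ t) (x : X) :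
    c * (2 / t * (k * ε - t / 2) - h x) ≤ ((G.eulerStep ε ^ k) f x).re := by
  have hnn := eulerStep_pow_nonneg (G := G) hε hf
  have hκ : 0 < 2 / t := by positivity
  -- before the time `t / 2` the lower barrier is not positive
  have hneg : ∀ r : ℝ, r ≤ t / 2 → ∀ y, c * (2 / t * (r - t / 2) - h y) ≤ 0 := fun r hr y =>
    mul_nonpos_of_nonneg_of_nonpos hc.le (by
      have := mul_nonpos_of_nonneg_of_nonpos hκ.le (sub_nonpos.2 hr)
      linarith [h0 y])
  have hle : ∀ r : ℝ, r ≤ t → ∀ y, c * (2 / t * (r - t / 2) - h y) ≤ c := fun r hr y => by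
    have h1 : 2 / t * (r - t / 2) ≤ 2 / t * (t - t / 2) :=
      mul_le_mul_of_nonneg_left (by linarith) hκ.le
    have h2 : 2 / t * (t - t / 2) = 1 := by field_simp; norm_num
    exact mul_le_of_le_one_right hc.le (by linarith [h0 y])
  induction k generalizing x with
  | zero =>
    refine (hneg _ ?_ x).trans (hnn 0 x)
    simpa using (half_pos ht).le
  | succ k ih =>
    have hcast : ((k + 1 : ℕ) : ℝ) * ε = k * ε + ε := by push_cast; ring
    have ih' := ih (by linarith)
    rw [eulerStep_pow_succ_apply]
    set g := (G.eulerStep ε ^ k) f with hg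
    set r : ℝ := ((k + 1 : ℕ) : ℝ) * ε with hr
    set K := C + c with hK
    have hgC : ∀ y, (G.eulerStep ε g y).re ≤ C := fun y => by
      rw [hg, ← eulerStep_pow_succ_apply]
      exact eulerStep_pow_le_const hε hC hfC (k + 1) y
    have hv : ∀ y, (((K : ℂ) • one - G.eulerStep ε g : G.L2) y).re =
        K - (G.eulerStep ε g y).re := fun y => by
      rw [coe_sub, Pi.sub_apply, coe_smul, Pi.smul_apply, hone1, Complex.sub_re, smul_eq_mul,
        mul_one, Complex.ofReal_re]
    have hmain := G.le_of_supersolution_off hε (u := (K : ℂ) • one - G.eulerStep ε g)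
      (sub_mem (Submodule.smul_mem _ _ hone) (G.eulerStep_mem_formDomain hε g))
      (fun y => by rw [hv]; linarith [hgC y])
      (w := fun y => K - c * (2 / t * (r - t / 2) - h y))
      (fun y => by linarith [hle r hk y]) (fun y => ?_) x
    · rw [hv] at hmain
      linarith
    · simp only [hv]
      by_cases hy : y ∈ B
      · left
        rcases le_total r (t / 2) with hr2 | hr2
        · linarith [hneg r hr2 y, G.eulerStep_nonneg hε (hnn k) y]
        · have := hu y hy (k + 1) hk hr2
          rw [eulerStep_pow_succ_apply] at this
          linarith [hle r hk y]
      · right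
        have e1 : (fun y => K - c * (2 / t * (r - t / 2) - h y)) =
            fun y => (K - c * (2 / t * (r - t / 2))) - (-c) * h y := by
          funext y
          ring
        rw [lap_const_sub, e1, lap_const_sub, lap_const_mul]
        have h1 := G.eulerStep_re_eq hε g y
        have h2 := ih' y
        have h3 := mul_le_mul_of_nonneg_left (hB y hy) (mul_pos hc hε).le
        rw [hcast]
        nlinarith

/-- Under the summability condition the heat kernel is bounded below at infinity. -/
theorem exists_heatKernel_ge [Infinite X] (hconn : G.graph.Connected) {x₀ : X}
    (h : Summable fun r : ℕ =>
      (G.maxDeg x₀ (r + 1) - G.minInnerDeg x₀ (r + 1) + 1) / G.minInnerDeg x₀ (r + 1))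
    (x : X) {t : ℝ} (ht : 0 < t) : ∃ c : ℝ, 0 < c ∧ ∀ y, c ≤ G.heatKernel t x y := by
  obtain ⟨hE, hM⟩ := summable_sphereBoundary hconn h
  obtain ⟨one, hone, hone1⟩ := exists_one_mem_formDomain hconn hM hE.tendsto_atTop_zero
  obtain ⟨N, u, hu0, hu1, hu⟩ := exists_radial_lap_ge hconn h (κ := 2 / t) (by positivity)
  choose c hc hcz using fun z : X => exists_eulerStep_pow_ge hconn x t z (t / 2) (half_pos ht)
  have hfin := finite_ball hconn x₀ N
  obtain ⟨z, -, hz⟩ := Finset.exists_min_image hfin.toFinset c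
    ⟨x₀, by simp⟩
  refine ⟨c z / 2, half_pos (hc z), fun y => ?_⟩
  refine ge_of_tendsto' (tendsto_eulerStep_pow_heatKernel ht x y) fun j => ?_
  have hjt : ((2 ^ j : ℕ) : ℝ) * (t / 2 ^ j) = t := by
    push_cast
    field_simp
  have hmx : 0 ≤ 1 / G.m x := (one_div_pos.2 (G.m_pos x)).le
  have hdelta : ∀ y, (G.delta x y).re ≤ 1 / G.m x := fun y => by
    rcases eq_or_ne y x with rfl | hy
    · rw [delta_re_self]
    · rw [delta_re_of_ne hy]
      exact hmx
  have key := eulerStep_pow_ge_of_lap_ge hone hone1 (delta_re_nonneg x) hmx hdelta ht (hc z) hu0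
    (B := {y | G.graph.dist x₀ y ≤ N}) (fun y hy => hu y (not_le.1 hy))
    (ε := t / 2 ^ j) (by positivity)
    (fun w hw k hk hk2 => (hz w (hfin.mem_toFinset.2 hw)).trans (hcz w _ (by positivity) k hk hk2))
    (2 ^ j) hjt.le y
  refine le_trans ?_ key
  rw [hjt]
  have h2 : 2 / t * (t - t / 2) = 1 := by field_simp; norm_num
  rw [h2, div_eq_mul_one_div]
  exact mul_le_mul_of_nonneg_left (by linarith [hu1 y]) (hc z).le

end WeightedGraph

theorem theorem3p2 {X : Type*} [Countable X] [Infinite X]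
    [MeasurableSpace X] [DiscreteMeasurableSpace X]
    (G : WeightedGraph X) (hconn : G.graph.Connected) :
    ((∃ x₀ : X, ¬ Summable fun r : ℕ => 1 / G.maxInnerDeg x₀ (r + 1)) → G.IsFeller) ∧
    ((∃ x₀ : X, Summable fun r : ℕ =>
        (G.maxDeg x₀ (r + 1) - G.minInnerDeg x₀ (r + 1) + 1) / G.minInnerDeg x₀ (r + 1)) →
      ¬ G.IsFeller ∧ ∀ x : X, ∀ t : ℝ, 0 < t → ¬ G.VanishesAtInfinity t x) := by
  refine ⟨fun ⟨x₀, h⟩ => WeightedGraph.isFeller_of_not_summable hconn h, fun ⟨x₀, h⟩ => ?_⟩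
  have key : ∀ x : X, ∀ t : ℝ, 0 < t → ¬ G.VanishesAtInfinity t x := by
    intro x t ht hv
    obtain ⟨c, hc, hle⟩ := WeightedGraph.exists_heatKernel_ge hconn h x ht
    obtain ⟨y, hy⟩ := (hv.eventually_lt_const hc).exists
    exact (hle y).not_gt hy
  exact ⟨fun hF => key x₀ 1 one_pos (hF x₀ 1 one_pos), key⟩
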